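/- Let $G$ be a compact connected Lie group with Lie algebra $\mathfrak g$, let $S^1=\mathbb R/2\pi\mathbb Z$, and let $\Omega G$ be the group of smooth maps $\gamma\colon S^1\to G$ with $\gamma(0)=1$, with Lie algebra $\Omega\mathfrak g$ of smooth maps $S^1\to\mathfrak g$ vanishing at $0$. Let $\pi\colon P\to M$ be a smooth principal $\Omega G$-bundle over a manifold $M$, possibly infinite-dimensional (or, more generally, over a diffeological space $M$; manifolds are regarded as diffeological spaces, the plots being the smooth maps from $\mathbb R^n$, and smooth maps and differential forms are understood through plots). Let $A$ be a connection on $P$, that is, an $\Omega\mathfrak g$-valued $1$-form which restricts to the Maurer–Cartan form on the orbits and is equivariant under $\Omega G$, and let $\Phi$ be a Higgs field, that is, a smooth map $\Phi\colon P\to C^\infty(S^1,\mathfrak g)$ with $$\Phi(p\gamma)=\mathrm{Ad}(\gamma^{-1})\Phi(p)+\gamma^{-1}\partial\gamma\qquad(p\in P,\ \gamma\in\Omega G).$$ Let $\widetilde P=(P\times G\times S^1)/\Omega G$, where $(p,g,\theta)\gamma=(p\gamma,\gamma(\theta)^{-1}g,\theta)$, be the caloron transform of $P$, with projection $\tilde\pi\colon\widetilde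 P\to M\times S^1$, $[p,g,\theta]\mapsto(\pi(p),\theta)$, and let $\tilde A$ be the $\mathfrak g$-valued $1$-form on $\widetilde P$ whose pullback to $P\times G\times S^1$ is $$\mathrm{Ad}(g^{-1})A(\theta)+\Theta+\mathrm{Ad}(g^{-1})\Phi\,d\theta,$$ with $\Theta$ the left-invariant Maurer–Cartan form of $G$. Let $\tilde F=d\tilde A+\tfrac12[\tilde A,\tilde A]$. Let $k\ge1$, let $f\colon\mathfrak g^k\to\mathbb R$ be a symmetric multilinear $\mathrm{Ad}$-invariant function, and let $cw_f(\tilde A)\in\Omega^{2k}(M\times S^1)$ be the form whose pullback along $\tilde\pi$ is $f(\tilde F,\dots,\tilde F)$. Then the string form $$s_f(A,\Phi)=\int_{S^1}cw_f(\tilde A)\in\Omega^{2k-1}(M)$$ (the integral over the fibre of $M\times S^1\to M$, normalised by $\int_{S^1}\alpha\wedge d\theta=\int_0^{2\pi}\alpha\,d\theta$) is well defined, i.e. there is exactly one form on $M$ obtained in this way, and it is closed: $d\,s_f(A,\Phi)=0$. -/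

import Mathlib

/-
Smooth structures are handled through plots (Mathlib's `DiffeologicalSpace`): a smooth structure
on a space is recorded by the smooth maps from the spaces `ℝⁿ` into it. Every smooth manifold,
of finite dimension or modelled on Fréchet spaces, is such a space, its plots being its smooth maps
from `ℝⁿ`; for these manifolds smooth maps and differential forms in the usual sense are the same
as smooth maps and differential forms in the sense used here.
The Lie group `G` is a Mathlib Lie group modelled on `E`; its Lie algebra `T₁G` is `E` as a vector
space, with the bracket of Mathlib's `GroupLieAlgebra`.
-/

open scoped Manifold ContDiff Topology
open Diffeology

namespace Caloron

noncomputable section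

/-- The test space `ℝⁿ`. -/
abbrev Euc (n : ℕ) : Type := EuclideanSpace ℝ (Fin n)

/-- The circle `ℝ / 2πℤ`. -/
abbrev S1 : Type := AddCircle (2 * Real.pi)

/-! ### Diffeologies -/

/-- The smooth structure of `ℝ / 2πℤ`: the quotient diffeology, that is, the finest one containing
the classes of all smooth real valued functions. -/
instance : DiffeologicalSpace S1 :=
  DiffeologicalSpace.generateFrom
    {q | ∃ θ : Euc q.1 → ℝ, ContDiff ℝ ∞ θ ∧ q.2 = fun x => (θ x : S1)}

/-- The product diffeology. -/
instance {X Y : Type*} [DiffeologicalSpace X] [DiffeologicalSpace Y] :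
    DiffeologicalSpace (X × Y) where
  plots n := {p | IsPlot (fun x => (p x).1) ∧ IsPlot (fun x => (p x).2)}
  constant_plots x := ⟨isPlot_const, isPlot_const⟩
  plot_reparam hp hf := ⟨isPlot_reparam hp.1 hf, isPlot_reparam hp.2 hf⟩
  locality hp := by
    constructor
    · refine DiffeologicalSpace.locality fun x => ?_
      obtain ⟨u, hu, hx, h⟩ := hp x
      exact ⟨u, hu, hx, fun hfu hf => (h hfu hf).1⟩
    · refine DiffeologicalSpace.locality fun x => ?_
      obtain ⟨u, hu, hx, h⟩ := hp x
      exact ⟨u, hu, hx, fun hfu hf => (h hfu hf).2⟩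

/-- The diffeology pulled back along a map `f`. -/
@[reducible]
def pullbackDiffeology {X Y : Type*} (d : DiffeologicalSpace Y) (f : X → Y) :
    DiffeologicalSpace X where
  plots n := {p | IsPlot (f ∘ p)}
  constant_plots x := isPlot_const
  plot_reparam hp hf := isPlot_reparam (X := Y) hp hf
  locality hp := by
    refine DiffeologicalSpace.locality fun x => ?_
    obtain ⟨u, hu, hx, h⟩ := hp x
    exact ⟨u, hu, hx, fun hfu hf => h hfu hf⟩

/-! ### Differential forms -/

/-- A smooth differential `k`-form on `X` with values in `V`: a smooth form on `ℝⁿ` for every plot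
`ℝⁿ → X` (the pullback of the form along the plot), compatibly with smooth changes of
parameters. -/
@[ext]
structure DForm (X : Type*) [DiffeologicalSpace X] (V : Type*) [NormedAddCommGroup V]
    [NormedSpace ℝ V] (k : ℕ) where
  /-- The pullback of the form along the plot `p`. -/
  onPlot : ∀ {n : ℕ} (p : Euc n → X), IsPlot p → Euc n → (Euc n) [⋀^Fin k]→L[ℝ] V
  smooth : ∀ {n : ℕ} (p : Euc n → X) (hp : IsPlot p), ContDiff ℝ ∞ (onPlot p hp)
  pullback : ∀ {m n : ℕ} (p : Euc n → X) (hp : IsPlot p) (φ : Euc m → Euc n)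
    (hφ : ContDiff ℝ ∞ φ) (x : Euc m),
    onPlot (p ∘ φ) (isPlot_reparam hp hφ) x =
      (onPlot p hp (φ x)).compContinuousLinearMap (fderiv ℝ φ x)

/-- A form is closed if its exterior derivative, which is computed on plots, vanishes. -/
def DForm.IsClosed {X : Type*} [DiffeologicalSpace X] {V : Type*} [NormedAddCommGroup V]
    [NormedSpace ℝ V] {k : ℕ} (β : DForm X V k) : Prop :=
  ∀ (n : ℕ) (p : Euc n → X) (hp : IsPlot p) (x : Euc n), extDeriv (β.onPlot p hp) x = 0

/-! ### Integration over the fibre of `M × S¹ → M` -/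

/-- The point `(x, t)` of `ℝⁿ⁺¹ = ℝⁿ × ℝ`. -/
def snocE {n : ℕ} (x : Euc n) (t : ℝ) : Euc (n + 1) :=
  WithLp.toLp 2 (Fin.snoc (α := fun _ => ℝ) (fun i => x i) t)

/-- The projection of `ℝⁿ⁺¹ = ℝⁿ × ℝ` to `ℝⁿ`. -/
def initE {n : ℕ} (y : Euc (n + 1)) : Euc n := WithLp.toLp 2 (fun i => y i.castSucc)

/-- The plot `(x, t) ↦ (p(x), t mod 2π)` of `M × S¹` given by a plot `p` of `M`. -/
def cyl {M : Type*} {n : ℕ} (p : Euc n → M) (y : Euc (n + 1)) : M × S1 :=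
  (p (initE y), ((y (Fin.last n) : ℝ) : S1))

theorem isPlot_cyl {M : Type*} [DiffeologicalSpace M] {n : ℕ} {p : Euc n → M} (hp : IsPlot p) :
    IsPlot (cyl p) := by
  refine ⟨isPlot_reparam hp (f := initE) ?_, DiffeologicalSpace.isPlot_generatedFrom_of_mem
    ⟨fun y : Euc (n + 1) => y (Fin.last n), by fun_prop, rfl⟩⟩
  unfold initE
  fun_prop

/-- `σ = ∫_{S¹} β`: the form `σ` on `M` is obtained from the form `β` on `M × S¹` by contraction
with `∂/∂θ` in the last slot and integration over `0 ≤ θ ≤ 2π`; so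
`∫_{S¹} α ∧ dθ = ∫ α dθ`. -/
def IsFibreIntegral {M : Type*} [DiffeologicalSpace M] {q : ℕ} (β : DForm (M × S1) ℝ (q + 1))
    (σ : DForm M ℝ q) : Prop :=
  ∀ (n : ℕ) (p : Euc n → M) (hp : IsPlot p) (x : Euc n) (v : Fin q → Euc n),
    σ.onPlot p hp x v = ∫ t in (0 : ℝ)..(2 * Real.pi),
      β.onPlot (cyl p) (isPlot_cyl hp) (snocE x t)
        (Fin.snoc (α := fun _ => Euc (n + 1)) (fun i => snocE (v i) 0) (snocE 0 1))

/-! ### The Lie group and its loop group -/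

section LieGroupData

variable (E : Type*) [NormedAddCommGroup E] [NormedSpace ℝ E]
  {G : Type*} [TopologicalSpace G] [ChartedSpace E G] [Group G]

/-- The adjoint action of `g` on the Lie algebra. -/
def Ad (g : G) : E →L[ℝ] E :=
  mfderiv 𝓘(ℝ, E) 𝓘(ℝ, E) (fun x : G => g * x * g⁻¹) 1

/-- The pullback `g⁻¹dg` of the left invariant Maurer-Cartan form along a map `g` from a normed
space into the group. -/
def leftLog {F : Type*} [NormedAddCommGroup F] [NormedSpace ℝ F] (g : F → G) (x : F) : F →L[ℝ] E :=
  mfderiv 𝓘(ℝ, F) 𝓘(ℝ, E) (fun y => (g x)⁻¹ * g y) x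

variable (G)

/-- The bracket of the Lie algebra of `G`. -/
def lieB (v w : E) : E :=
  Bracket.bracket (L := GroupLieAlgebra 𝓘(ℝ, E) G) (M := GroupLieAlgebra 𝓘(ℝ, E) G) v w

/-- An invariant polynomial of degree `k`: a symmetric `k`-linear function on the Lie algebra that
is invariant under the adjoint action. -/
structure InvariantPolynomial (k : ℕ) where
  toFun : MultilinearMap ℝ (fun _ : Fin k => E) ℝ
  symm : ∀ (σ : Equiv.Perm (Fin k)) (v : Fin k → E), toFun (fun i => v (σ i)) = toFun v
  invariant : ∀ (g : G) (v : Fin k → E), toFun (fun i => Ad E g (v i)) = toFun v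

variable [LieGroup 𝓘(ℝ, E) ∞ G]

/-- The based loop group `ΩG`: smooth maps `S¹ → G` taking `0` to the identity, with pointwise
multiplication. -/
def LoopGroup : Subgroup (S1 → G) where
  carrier := {γ | ContMDiff 𝓘(ℝ, ℝ) 𝓘(ℝ, E) ∞ (fun t : ℝ => γ (t : S1)) ∧ γ 0 = 1}
  mul_mem' ha hb := ⟨ha.1.mul hb.1, by simp [ha.2, hb.2]⟩
  one_mem' := ⟨contMDiff_const, rfl⟩
  inv_mem' ha := ⟨ha.1.inv, by simp [ha.2]⟩

variable {E G}

/-- Smoothness of a map `ℝⁿ → ΩG`, that is, joint smoothness of `ℝⁿ × S¹ → G`. -/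
def SmoothLoops {n : ℕ} (γ : Euc n → LoopGroup E G) : Prop :=
  ContMDiff 𝓘(ℝ, Euc n × ℝ) 𝓘(ℝ, E) ∞ (fun y : Euc n × ℝ => (γ y.1 : S1 → G) (y.2 : S1))

theorem smoothLoops_const {n : ℕ} (γ : LoopGroup E G) : SmoothLoops (fun _ : Euc n => γ) :=
  γ.2.1.comp (contDiff_snd : ContDiff ℝ ∞ (Prod.snd : Euc n × ℝ → ℝ)).contMDiff

end LieGroupData

/-! ### `ΩG`-bundles -/

section Bundles

variable (E : Type*) [NormedAddCommGroup E] [NormedSpace ℝ E]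
  (G : Type*) [TopologicalSpace G] [ChartedSpace E G] [Group G] [LieGroup 𝓘(ℝ, E) ∞ G]
  (P : Type*) [DiffeologicalSpace P] (M : Type*) [DiffeologicalSpace M]

/-- A smooth principal `ΩG`-bundle `P → M`. (`M` may be any smooth manifold, also an
infinite dimensional one.) -/
structure LoopBundle where
  /-- The projection. -/
  proj : P → M
  /-- The right action of `ΩG`. -/
  act : P → LoopGroup E G → P
  act_one : ∀ p, act p 1 = p
  act_mul : ∀ p γ δ, act p (γ * δ) = act (act p γ) δ
  /-- The action is free. -/
  free : ∀ p γ, act p γ = p → γ = 1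
  proj_act : ∀ p γ, proj (act p γ) = proj p
  proj_smooth : DSmooth proj
  act_smooth : ∀ {n : ℕ} (a : Euc n → P) (γ : Euc n → LoopGroup E G), IsPlot a → SmoothLoops γ →
    IsPlot (fun x => act (a x) (γ x))
  /-- Local triviality: near every point of `M` there is a smooth section `s` such that
  `(x, γ) ↦ s(x)γ` is a diffeomorphism from `U × ΩG` onto the part of `P` over `U`. -/
  locally_trivial : ∀ m : M, ∃ U : Set M, IsOpen[dTopology] U ∧ m ∈ U ∧ ∃ s : M → P,
    (∀ x ∈ U, proj (s x) = x) ∧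
    (∀ (n : ℕ) (b : Euc n → M), IsPlot b → (∀ x, b x ∈ U) → IsPlot (fun x => s (b x))) ∧
    (∀ (n : ℕ) (a : Euc n → P), IsPlot a → (∀ x, proj (a x) ∈ U) →
      ∃ γ : Euc n → LoopGroup E G, SmoothLoops γ ∧ ∀ x, a x = act (s (proj (a x))) (γ x))

end Bundles

namespace LoopBundle

variable {E : Type*} [NormedAddCommGroup E] [NormedSpace ℝ E]
  {G : Type*} [TopologicalSpace G] [ChartedSpace E G] [Group G] [LieGroup 𝓘(ℝ, E) ∞ G]
  {P : Type*} [DiffeologicalSpace P] {M : Type*} [DiffeologicalSpace M]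
  (B : LoopBundle E G P M)

/-- A connection on an `ΩG`-bundle `P`: a smooth 1-form `A` on `P` with values in the Lie algebra
`Ω𝔤` of smooth loops in `𝔤` vanishing at `0`, which restricts to the Maurer-Cartan form on the
orbits and is equivariant. `A.form a ha θ x v` is the value at `θ` of the loop `A(da(v))`. -/
structure Connection where
  form : ∀ {n : ℕ} (a : Euc n → P), IsPlot a → S1 → Euc n → Euc n →L[ℝ] E
  smooth : ∀ {n : ℕ} (a : Euc n → P) (ha : IsPlot a),
    ContDiff ℝ ∞ (fun y : Euc n × ℝ => form a ha (y.2 : S1) y.1)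
  based : ∀ {n : ℕ} (a : Euc n → P) (ha : IsPlot a) (x : Euc n), form a ha 0 x = 0
  pullback : ∀ {m n : ℕ} (a : Euc n → P) (ha : IsPlot a) (φ : Euc m → Euc n)
    (hφ : ContDiff ℝ ∞ φ) (θ : S1) (x : Euc m),
    form (a ∘ φ) (isPlot_reparam ha hφ) θ x = (form a ha θ (φ x)).comp (fderiv ℝ φ x)
  vertical : ∀ {n : ℕ} (p : P) (γ : Euc n → LoopGroup E G) (hγ : SmoothLoops γ) (θ : S1)
    (x : Euc n), form (fun y => B.act p (γ y)) (B.act_smooth _ γ isPlot_const hγ) θ x =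
      leftLog E (fun y => (γ y : S1 → G) θ) x
  equivariant : ∀ {n : ℕ} (a : Euc n → P) (ha : IsPlot a) (γ : LoopGroup E G) (θ : S1) (x : Euc n),
    form (fun y => B.act (a y) γ) (B.act_smooth a _ ha (smoothLoops_const γ)) θ x =
      (Ad E ((γ : S1 → G) θ)⁻¹).comp (form a ha θ x)

/-- A Higgs field: a smooth map `Φ` from `P` to the smooth maps `S¹ → 𝔤` with
`Φ(pγ) = Ad(γ⁻¹)Φ(p) + γ⁻¹∂γ`. The loops `Φ(p)` are not based: as `γ⁻¹∂γ` need not vanish at `0`,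
the equivariance would be contradictory for based loops. -/
structure HiggsField where
  toFun : P → S1 → E
  smooth : ∀ {n : ℕ} (a : Euc n → P), IsPlot a →
    ContDiff ℝ ∞ (fun y : Euc n × ℝ => toFun (a y.1) (y.2 : S1))
  equivariant : ∀ (p : P) (γ : LoopGroup E G) (t : ℝ),
    toFun (B.act p γ) (t : S1) = Ad E ((γ : S1 → G) (t : S1))⁻¹ (toFun p (t : S1)) +
      leftLog E (fun s : ℝ => (γ : S1 → G) (s : S1)) t 1

/-! ### The caloron transform -/

/-- Orbits of the action `(p, g, θ)γ = (pγ, γ(θ)⁻¹g, θ)` of `ΩG` on `P × G × S¹`. -/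
def caloronSetoid : Setoid (P × G × S1) where
  r y z := ∃ γ : LoopGroup E G,
    z = (B.act y.1 γ, ((γ : S1 → G) y.2.2)⁻¹ * y.2.1, y.2.2)
  iseqv :=
    { refl := fun y => ⟨1, by simp [B.act_one]⟩
      symm := by
        rintro y _ ⟨γ, rfl⟩
        exact ⟨γ⁻¹, by simp [← B.act_mul, B.act_one]⟩
      trans := by
        rintro y _ _ ⟨γ, rfl⟩ ⟨δ, rfl⟩
        exact ⟨γ * δ, by simp [B.act_mul, mul_assoc]⟩ }

/-- The total space of the caloron transform, `(P × G × S¹)/ΩG`. -/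
def Total : Type _ := Quotient B.caloronSetoid

/-- The class `[p, g, θ]`. -/
def cmk (p : P) (g : G) (θ : S1) : B.Total := Quotient.mk B.caloronSetoid (p, g, θ)

/-- The quotient diffeology: the finest one for which the classes of smooth families of points
of `P × G × S¹` are smooth. -/
instance : DiffeologicalSpace B.Total :=
  DiffeologicalSpace.generateFrom
    {q | ∃ (a : Euc q.1 → P) (g : Euc q.1 → G) (θ : Euc q.1 → ℝ),
      IsPlot a ∧ ContMDiff 𝓘(ℝ, Euc q.1) 𝓘(ℝ, E) ∞ g ∧ ContDiff ℝ ∞ θ ∧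
      q.2 = fun x => B.cmk (a x) (g x) (θ x : S1)}

theorem isPlot_cmk {n : ℕ} {a : Euc n → P} {g : Euc n → G} {θ : Euc n → ℝ} (ha : IsPlot a)
    (hg : ContMDiff 𝓘(ℝ, Euc n) 𝓘(ℝ, E) ∞ g) (hθ : ContDiff ℝ ∞ θ) :
    IsPlot (fun x => B.cmk (a x) (g x) (θ x : S1)) :=
  DiffeologicalSpace.isPlot_generatedFrom_of_mem ⟨a, g, θ, ha, hg, hθ, rfl⟩

/-- The projection `[p, g, θ] ↦ (π(p), θ)` of the caloron transform to `M × S¹`. -/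
def cproj : B.Total → M × S1 :=
  Quotient.lift (fun y : P × G × S1 => (B.proj y.1, y.2.2)) (by
    rintro y _ ⟨γ, rfl⟩
    simp [B.proj_act])

theorem dSmooth_cproj : DSmooth B.cproj := by
  have h : (inferInstance : DiffeologicalSpace B.Total) ≤
      pullbackDiffeology inferInstance B.cproj := by
    refine DiffeologicalSpace.generateFrom_le_iff.2 ?_
    rintro n p ⟨a, g, θ, ha, -, hθ, hp⟩
    change p = _ at hp
    rw [hp]
    exact ⟨B.proj_smooth _ a ha, DiffeologicalSpace.isPlot_generatedFrom_of_mem ⟨θ, hθ, rfl⟩⟩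
  exact fun n p hp => DiffeologicalSpace.le_iff'.1 h n p hp

variable {B}

/-- `Ã` is the form on the caloron transform whose pullback to `P × G × S¹` is
`Ad(g⁻¹)A(θ) + Θ + Ad(g⁻¹)Φ dθ`. -/
def IsCaloronConnection (A : B.Connection) (Φ : B.HiggsField) (Ã : DForm B.Total E 1) : Prop :=
  ∀ (n : ℕ) (a : Euc n → P) (g : Euc n → G) (θ : Euc n → ℝ) (ha : IsPlot a)
    (hg : ContMDiff 𝓘(ℝ, Euc n) 𝓘(ℝ, E) ∞ g) (hθ : ContDiff ℝ ∞ θ) (x v : Euc n),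
    Ã.onPlot _ (B.isPlot_cmk ha hg hθ) x ![v] =
      Ad E (g x)⁻¹ (A.form a ha (θ x : S1) x v) + leftLog E g x v +
        fderiv ℝ θ x v • Ad E (g x)⁻¹ (Φ.toFun (a x) (θ x : S1))

/-- The curvature `dÃ + ½[Ã, Ã]` along the plot `q`, at the point `x`, on the vectors `u, v`. -/
def curvature (Ã : DForm B.Total E 1) {n : ℕ} (q : Euc n → B.Total) (hq : IsPlot q)
    (x u v : Euc n) : E :=
  extDeriv (Ã.onPlot q hq) x ![u, v] + lieB E G (Ã.onPlot q hq x ![u]) (Ã.onPlot q hq x ![v])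

/-- `β = cw_f(Ã)`: the `2k`-form `β` on `M × S¹` is the descent of the form `f(F̃, …, F̃)`, that is
`(v₁, …, v₂ₖ) ↦ 2⁻ᵏ ∑_σ sgn(σ) f(F̃(v_σ(1), v_σ(2)), …, F̃(v_σ(2k-1), v_σ(2k)))`,
on the caloron transform. -/
def IsChernWeilForm {k : ℕ} (f : InvariantPolynomial E G k) (Ã : DForm B.Total E 1)
    (β : DForm (M × S1) ℝ (2 * k)) : Prop :=
  ∀ (n : ℕ) (q : Euc n → B.Total) (hq : IsPlot q) (x : Euc n) (v : Fin (2 * k) → Euc n),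
    β.onPlot (B.cproj ∘ q) (B.dSmooth_cproj n q hq) x v =
      (1 / 2 ^ k : ℝ) * ∑ σ : Equiv.Perm (Fin (2 * k)), ((Equiv.Perm.sign σ : ℤ) : ℝ) *
        f.toFun (fun i : Fin k => curvature Ã q hq x
          (v (σ ⟨2 * i, by omega⟩)) (v (σ ⟨2 * i + 1, by omega⟩)))

/-- `σ` is the string form `s_f(A, Φ) = ∫_{S¹} cw_f(Ã)`, for `f` of degree `k + 1`. -/
def IsStringForm (A : B.Connection) (Φ : B.HiggsField) {k : ℕ} (f : InvariantPolynomial E G (k + 1))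
    (σ : DForm M ℝ (2 * k + 1)) : Prop :=
  ∃ (Ã : DForm B.Total E 1) (β : DForm (M × S1) ℝ (2 * (k + 1))),
    IsCaloronConnection A Φ Ã ∧ IsChernWeilForm f Ã β ∧ IsFibreIntegral (q := 2 * k + 1) β σ

end LoopBundle

end

end Caloron

/-! The string form arises in three stages: the caloron connection `Ã`, its Chern-Weil form on `M ×
S¹`, and the integral over the fibre. Each stage has exactly one outcome. Uniqueness is local: a
form along a plot depends only on the germ of the plot (`DForm.onPlot_congr`), and plots of
`B.Total` and of `M × S¹` lift locally. Existence comes from gluing local representatives that agree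
(`exists_dForm`); the fibre integral is written down directly.

Agreement rests on one computation, `calForm_act`. Under a family of loops `γ`, the connection
contributes `γ⁻¹dγ` at fixed `θ` and the Higgs field contributes `γ⁻¹∂γ dθ`. Together these are the
full logarithmic derivative of `γ(θ)`, which the factor `γ(θ)⁻¹` in the `G`-component cancels. Hence
two lifts of the same family in `M × S¹` give one-forms that differ by a gauge transformation `h`
(`exists_gauge`). Where the lifts have the same class in the caloron transform, `h = 1`, so `Ã`
descends. In general the curvature changes by `Ad(h⁻¹)` (`curv_gauge`), and invariance of `f` lets
`f(F̃, …, F̃)` descend to `M × S¹`.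

For closedness, the Bianchi identity (`fderiv_curv_cyclic`) replaces `dF̃` by `-[Ã, F̃]` under
alternation, and infinitesimal invariance of `f` (`InvariantPolynomial.sum_lieB`) makes the result
vanish (`extDeriv_cwForm_curv`). Integration over the fibre commutes with `d` up to sign and a
boundary term, and the latter is zero by periodicity (`IsFibreIntegral.isClosed`).

The Lie theory behind this is the Maurer-Cartan equation `fderiv_leftLog_sub`. Applied to products
`e(p)g(y)` it also yields the derivative of `Ad`. -/

namespace Caloron

noncomputable section

/-! ### Logarithmic derivatives of maps into a Lie group -/

section LieGroupCalculus

variable {E : Type*} [NormedAddCommGroup E] [NormedSpace ℝ E]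
  {G : Type*} [TopologicalSpace G] [ChartedSpace E G] [Group G]
  {F F' : Type*} [NormedAddCommGroup F] [NormedSpace ℝ F] [NormedAddCommGroup F'] [NormedSpace ℝ F']

variable (E) in
/-- The preferred chart at the identity. -/
def chartOne (g : G) : E := extChartAt 𝓘(ℝ, E) (1 : G) g

/-- The tangent space at `1` is identified with `E` through this very chart. Since the map defining
`leftLog` passes through `1`, logarithmic derivatives become ordinary ones. -/
theorem mfderiv_eq_fderiv_chartOne {f : F → G} {x : F}
    (hf : MDifferentiableAt 𝓘(ℝ, F) 𝓘(ℝ, E) f x) (hx : f x = 1) :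
    (mfderiv 𝓘(ℝ, F) 𝓘(ℝ, E) f x : F →L[ℝ] E) = fderiv ℝ (fun y => chartOne E (f y)) x := by
  rw [hf.mfderiv]
  have : writtenInExtChartAt 𝓘(ℝ, F) 𝓘(ℝ, E) x f = fun y => chartOne E (f y) := by
    ext y
    change extChartAt 𝓘(ℝ, E) (f x) (f y) = _
    rw [hx]
    rfl
  rw [this]
  rw [modelWithCornersSelf_coe, Set.range_id, fderivWithin_univ]
  rfl

theorem leftLog_congr {g h : F → G} {x : F} (hgh : g =ᶠ[𝓝 x] h) :
    leftLog E g x = leftLog E h x := by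
  unfold leftLog
  rw [hgh.eq_of_nhds]
  refine Filter.EventuallyEq.mfderiv_eq ?_
  filter_upwards [hgh] with y hy
  rw [hy]

theorem leftLog_const_mul (c : G) (g : F → G) (x : F) :
    leftLog E (fun y => c * g y) x = leftLog E g x := by
  unfold leftLog
  congr 1
  ext y
  group

@[simp]
theorem leftLog_const (c : G) (x : F) : leftLog E (fun _ : F => c) x = 0 := by
  unfold leftLog
  exact mfderiv_const

variable [LieGroup 𝓘(ℝ, E) ∞ G]

theorem contMDiffAt_chartOne : ContMDiffAt 𝓘(ℝ, E) 𝓘(ℝ, E) ∞ (chartOne E : G → E) 1 := by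
  have : IsManifold 𝓘(ℝ, E) ∞ G := inferInstance
  exact contMDiffAt_extChartAt

theorem contMDiffAt_translate {g : F → G} {x : F} (c : G)
    (hg : ContMDiffAt 𝓘(ℝ, F) 𝓘(ℝ, E) ∞ g x) :
    ContMDiffAt 𝓘(ℝ, F) 𝓘(ℝ, E) ∞ (fun y => c * g y) x :=
  contMDiffAt_const.mul hg

theorem contDiffAt_chartOne_comp {f : F → G} {x : F} (hf : ContMDiffAt 𝓘(ℝ, F) 𝓘(ℝ, E) ∞ f x)
    (hx : f x = 1) : ContDiffAt ℝ ∞ (fun y => chartOne E (f y)) x := by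
  have h := contMDiffAt_chartOne (E := E) (G := G)
  rw [← hx] at h
  exact (h.comp x hf).contDiffAt

theorem leftLog_eq_fderiv {g : F → G} {x : F} (hg : ContMDiffAt 𝓘(ℝ, F) 𝓘(ℝ, E) ∞ g x) :
    leftLog E g x = fderiv ℝ (fun y => chartOne E ((g x)⁻¹ * g y)) x :=
  mfderiv_eq_fderiv_chartOne ((contMDiffAt_translate _ hg).mdifferentiableAt (by simp)) (by simp)

theorem leftLog_comp {g : F → G} {φ : F' → F} {x : F'}
    (hg : ContMDiffAt 𝓘(ℝ, F) 𝓘(ℝ, E) ∞ g (φ x)) (hφ : ContDiffAt ℝ ∞ φ x) :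
    leftLog E (fun y => g (φ y)) x = (leftLog E g (φ x)).comp (fderiv ℝ φ x) := by
  rw [leftLog_eq_fderiv hg, leftLog_eq_fderiv (g := fun y => g (φ y)) (hg.comp x hφ.contMDiffAt)]
  exact fderiv_comp x (g := fun y => chartOne E ((g (φ x))⁻¹ * g y))
    ((contDiffAt_chartOne_comp (contMDiffAt_translate _ hg) (by simp)).differentiableAt (by simp))
    (hφ.differentiableAt (by simp))

theorem leftLog_prod {g : F × F' → G} {x : F} {y : F'}
    (hg : ContMDiffAt 𝓘(ℝ, F × F') 𝓘(ℝ, E) ∞ g (x, y)) (u : F) (v : F') :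
    leftLog E g (x, y) (u, v) =
      leftLog E (fun z => g (z, y)) x u + leftLog E (fun z => g (x, z)) y v := by
  have h1 : leftLog E (fun z => g (z, y)) x = _ :=
    leftLog_comp (φ := fun z => (z, y)) hg (by fun_prop)
  have h2 : leftLog E (fun z => g (x, z)) y = _ :=
    leftLog_comp (φ := fun z => (x, z)) hg (by fun_prop)
  rw [h1, h2, (hasFDerivAt_prodMk_left x y).fderiv,
    (hasFDerivAt_prodMk_right x y).fderiv]
  simp [← map_add]

theorem contMDiff_conj (c : G) :
    ContMDiff 𝓘(ℝ, E) 𝓘(ℝ, E) ∞ (fun x : G => c * x * c⁻¹) :=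
  (contMDiff_const.mul contMDiff_id).mul contMDiff_const

theorem leftLog_conj {g : F → G} {x : F} (c : G) (hg : ContMDiffAt 𝓘(ℝ, F) 𝓘(ℝ, E) ∞ g x) :
    leftLog E (fun y => c * g y * c⁻¹) x = (Ad E c).comp (leftLog E g x) := by
  have h := mfderiv_comp_of_eq (I := 𝓘(ℝ, F)) (I' := 𝓘(ℝ, E)) (I'' := 𝓘(ℝ, E))
    (g := fun x : G => c * x * c⁻¹) (f := fun y => (g x)⁻¹ * g y) (x := x) (y := 1)
    ((contMDiff_conj c).contMDiffAt.mdifferentiableAt (by simp))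
    ((contMDiffAt_translate _ hg).mdifferentiableAt (by simp)) (by simp)
  have h2 : (fun y => (c * g x * c⁻¹)⁻¹ * (c * g y * c⁻¹)) =
      (fun x : G => c * x * c⁻¹) ∘ (fun y => (g x)⁻¹ * g y) := by
    ext y
    simp only [Function.comp_apply]
    group
  have h3 : Ad E c = (mfderiv 𝓘(ℝ, E) 𝓘(ℝ, E) (fun x : G => c * x * c⁻¹) ((g x)⁻¹ * g x) :
      E →L[ℝ] E) := by
    rw [inv_mul_cancel]
    rfl
  unfold leftLog
  rw [h2, h3]
  exact h

theorem leftLog_mul_const {g : F → G} {x : F} (c : G) (hg : ContMDiffAt 𝓘(ℝ, F) 𝓘(ℝ, E) ∞ g x) :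
    leftLog E (fun y => g y * c) x = (Ad E c⁻¹).comp (leftLog E g x) := by
  rw [← leftLog_conj c⁻¹ hg, ← leftLog_const_mul c⁻¹ (fun y => g y * c)]
  congr 1
  ext y
  group

/-- Restrict `(y, z) ↦ g(y)h(z)` to the diagonal: in the first variable a constant right factor
produces `Ad`, in the second a constant left factor drops out. -/
theorem leftLog_mul {g h : F → G} {x : F} (hg : ContMDiffAt 𝓘(ℝ, F) 𝓘(ℝ, E) ∞ g x)
    (hh : ContMDiffAt 𝓘(ℝ, F) 𝓘(ℝ, E) ∞ h x) :
    leftLog E (fun y => g y * h y) x = (Ad E (h x)⁻¹).comp (leftLog E g x) + leftLog E h x := by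
  have hK : ContMDiffAt 𝓘(ℝ, F × F) 𝓘(ℝ, E) ∞ (fun z : F × F => g z.1 * h z.2) (x, x) :=
    ContMDiffAt.mul
      (ContMDiffAt.comp (g := g) (f := Prod.fst) (x, x) hg contDiffAt_fst.contMDiffAt)
      (ContMDiffAt.comp (g := h) (f := Prod.snd) (x, x) hh contDiffAt_snd.contMDiffAt)
  have h1 : leftLog E (fun y => g y * h y) x = _ :=
    leftLog_comp (φ := fun z => (z, z)) hK (by fun_prop)
  have h3 : fderiv ℝ (fun z : F => (z, z)) x = (ContinuousLinearMap.id ℝ F).prod (.id ℝ F) :=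
    ((hasFDerivAt_id x).prodMk (hasFDerivAt_id x)).fderiv
  ext v
  rw [h1, h3]
  simp only [ContinuousLinearMap.comp_apply, ContinuousLinearMap.prod_apply,
    add_apply, ContinuousLinearMap.id_apply]
  rw [leftLog_prod hK]
  dsimp only
  rw [leftLog_mul_const _ hg, leftLog_const_mul]
  rfl

theorem contDiff_leftLog {g : F → G} (hg : ContMDiff 𝓘(ℝ, F) 𝓘(ℝ, E) ∞ g) :
    ContDiff ℝ ∞ (leftLog E g) := by
  have : leftLog E g = fun x => fderiv ℝ (fun y => chartOne E ((g x)⁻¹ * g y)) x :=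
    funext fun x => leftLog_eq_fderiv hg.contMDiffAt
  rw [this, contDiff_iff_contDiffAt]
  intro x
  refine ContDiffAt.fderiv (n := ∞) (f := fun x y => chartOne E ((g x)⁻¹ * g y)) (g := id) ?_
    contDiffAt_id (by simp)
  refine contDiffAt_chartOne_comp (f := fun z : F × F => (g z.1)⁻¹ * g z.2) ?_ (by simp)
  exact (((hg.comp contDiff_fst.contMDiff).inv).mul (hg.comp contDiff_snd.contMDiff)).contMDiffAt

end LieGroupCalculus

/-! ### The Lie bracket in the chart at the identity and the Maurer-Cartan equation -/

section LieBracket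

open VectorField

variable {E : Type*} [NormedAddCommGroup E] [NormedSpace ℝ E]
  {G : Type*} [TopologicalSpace G] [ChartedSpace E G] [Group G]
  {F F' : Type*} [NormedAddCommGroup F] [NormedSpace ℝ F] [NormedAddCommGroup F'] [NormedSpace ℝ F']

/-- Plots have all of `ℝⁿ` as domain, so they cannot be restricted to a neighbourhood. Precomposing
with such a `φ` plays the role of restriction. -/
theorem exists_contDiff_mapsTo_eventuallyEq_id [HasContDiffBump F] {x : F} {U : Set F}
    (hU : U ∈ 𝓝 x) : ∃ φ : F → F, ContDiff ℝ ∞ φ ∧ (∀ y, φ y ∈ U) ∧ φ =ᶠ[𝓝 x] id := by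
  obtain ⟨r, hr, hrU⟩ := Metric.mem_nhds_iff.1 hU
  let χ : ContDiffBump x := ⟨r / 2, r, by positivity, by linarith⟩
  refine ⟨fun y => x + χ y • (y - x), ?_, fun y => hrU ?_, ?_⟩
  · exact contDiff_const.add (χ.contDiff.smul (contDiff_id.sub contDiff_const))
  · by_cases hy : dist y x < r
    · rw [mem_ball_iff_norm, add_sub_cancel_left, norm_smul, Real.norm_of_nonneg χ.nonneg]
      rw [dist_eq_norm] at hy
      exact (mul_le_of_le_one_left (norm_nonneg _) χ.le_one).trans_lt hy
    · simpa [χ.zero_of_le_dist (not_lt.1 hy)] using hr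
  · filter_upwards [χ.eventuallyEq_one] with y hy
    simp [hy]

variable [LieGroup 𝓘(ℝ, E) ∞ G] [FiniteDimensional ℝ E]

variable (E G) in
/-- Smooth global maps into a Lie group that restrict to the inverse of the chart at the
identity near the image of the identity. -/
theorem exists_param : ∃ e : E → G, ContMDiff 𝓘(ℝ, E) 𝓘(ℝ, E) ∞ e ∧
    (∀ᶠ p in 𝓝 (chartOne E (1 : G)), e p = (extChartAt 𝓘(ℝ, E) (1 : G)).symm p) ∧
    (∀ᶠ p in 𝓝 (chartOne E (1 : G)), chartOne E (e p) = p) ∧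
    e (chartOne E (1 : G)) = 1 := by
  have : IsManifold 𝓘(ℝ, E) ∞ G := inferInstance
  have ht : (extChartAt 𝓘(ℝ, E) (1 : G)).target ∈ 𝓝 (chartOne E (1 : G)) :=
    extChartAt_target_mem_nhds 1
  obtain ⟨φ, hφ, hm, heq⟩ := exists_contDiff_mapsTo_eventuallyEq_id ht
  have h1 : ∀ᶠ p in 𝓝 (chartOne E (1 : G)), (extChartAt 𝓘(ℝ, E) (1 : G)).symm (φ p) =
      (extChartAt 𝓘(ℝ, E) (1 : G)).symm p := heq.mono fun p hp => by rw [hp]; rfl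
  refine ⟨fun p => (extChartAt 𝓘(ℝ, E) (1 : G)).symm (φ p), ?_, h1, ?_, ?_⟩
  · exact (contMDiffOn_extChartAt_symm (n := ∞) (1 : G)).comp_contMDiff hφ.contMDiff hm
  · filter_upwards [ht, heq] with p hp hq
    rw [hq]
    exact (extChartAt 𝓘(ℝ, E) (1 : G)).right_inv hp
  · refine h1.self_of_nhds.trans ?_
    exact extChartAt_to_inv 1

omit [FiniteDimensional ℝ E] in
theorem leftLog_param {e : E → G} (he : ContMDiff 𝓘(ℝ, E) 𝓘(ℝ, E) ∞ e)
    (hce : ∀ᶠ p in 𝓝 (chartOne E (1 : G)), chartOne E (e p) = p) (h1 : e (chartOne E (1 : G)) = 1) :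
    leftLog E e (chartOne E (1 : G)) = ContinuousLinearMap.id ℝ E := by
  rw [leftLog_eq_fderiv he.contMDiffAt, h1]
  have : (fun y => chartOne E ((1 : G)⁻¹ * e y)) =ᶠ[𝓝 (chartOne E (1 : G))] id :=
    hce.mono fun p hp => by simpa using hp
  rw [this.fderiv_eq, fderiv_id]

variable (G) in
/-- The left invariant vector field with value `w` at the identity, in the chart there. -/
def invField (w : E) : E → E :=
  mpullbackWithin 𝓘(ℝ, E) 𝓘(ℝ, E) (extChartAt 𝓘(ℝ, E) (1 : G)).symm
    (mulInvariantVectorField (I := 𝓘(ℝ, E)) (G := G) w) (Set.range 𝓘(ℝ, E))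

omit [FiniteDimensional ℝ E] in
theorem lieB_eq_lieBracket (u v : E) :
    lieB E G u v = lieBracket ℝ (invField G u) (invField G v) (chartOne E (1 : G)) := by
  have h := mlieBracketWithin_apply (I := 𝓘(ℝ, E)) (s := Set.univ) (x₀ := (1 : G))
    (V := mulInvariantVectorField (I := 𝓘(ℝ, E)) (G := G) u)
    (W := mulInvariantVectorField (I := 𝓘(ℝ, E)) (G := G) v)
  have hs : (extChartAt 𝓘(ℝ, E) (1 : G)).symm ⁻¹' Set.univ ∩ Set.range 𝓘(ℝ, E) = Set.univ := by
    simp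
  rw [hs, mfderiv_extChartAt_self] at h
  refine h.trans ?_
  rw [← lieBracketWithin_univ]
  exact DFunLike.congr_fun (ContinuousLinearMap.inverse_id (R := ℝ) (M := E)) _

omit [FiniteDimensional ℝ E] in
-- In the chart, the left-invariant field with value `w` at `1` is the derivative of `q ↦ e(p)e(q)`
-- at the base point in direction `w`. Hence the bracket is the antisymmetrised mixed second
-- derivative of the multiplication.
theorem lieB_eq_fderiv {e : E → G} (he : ContMDiff 𝓘(ℝ, E) 𝓘(ℝ, E) ∞ e)
    (hes : ∀ᶠ p in 𝓝 (chartOne E (1 : G)), e p = (extChartAt 𝓘(ℝ, E) (1 : G)).symm p)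
    (hce : ∀ᶠ p in 𝓝 (chartOne E (1 : G)), chartOne E (e p) = p) (h1 : e (chartOne E (1 : G)) = 1)
    (u v : E) :
    lieB E G u v =
      fderiv ℝ (fun p => fderiv ℝ (fun q => chartOne E (e p * e q)) (chartOne E (1 : G)) v)
        (chartOne E (1 : G)) u -
      fderiv ℝ (fun p => fderiv ℝ (fun q => chartOne E (e p * e q)) (chartOne E (1 : G)) u)
        (chartOne E (1 : G)) v := by
  have : IsManifold 𝓘(ℝ, E) ∞ G := inferInstance
  have : IsManifold 𝓘(ℝ, E) 1 G := IsManifold.of_le (n := ∞) (by simp)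
  have hd : (mfderiv 𝓘(ℝ, E) 𝓘(ℝ, E) e (chartOne E (1 : G)) : E →L[ℝ] E) = .id ℝ E := by
    rw [← leftLog_param he hce h1]
    have h2 : (fun y => (e (chartOne E (1 : G)))⁻¹ * e y) = e := by simp [h1]
    unfold leftLog
    rw [h2]
  have key : ∀ w : E, invField G w
      =ᶠ[𝓝 (chartOne E (1 : G))]
      fun p => fderiv ℝ (fun q => chartOne E (e p * e q)) (chartOne E (1 : G)) w := by
    intro w
    have ht : (extChartAt 𝓘(ℝ, E) (1 : G)).target ∈ 𝓝 (chartOne E (1 : G)) :=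
      extChartAt_target_mem_nhds 1
    filter_upwards [ht, hes] with p hp hpe
    have hps : e p ∈ (extChartAt 𝓘(ℝ, E) (1 : G)).source := by
      rw [hpe]
      exact (extChartAt 𝓘(ℝ, E) (1 : G)).map_target hp
    unfold invField
    rw [mpullbackWithin_apply, ContinuousLinearMap.inverse_eq
      (mfderivWithin_extChartAt_symm_comp_mfderiv_extChartAt hp)
      (mfderiv_extChartAt_comp_mfderivWithin_extChartAt_symm hp)]
    rw [← hpe]
    have hc : ContMDiffAt 𝓘(ℝ, E) 𝓘(ℝ, E) ∞ (chartOne E : G → E) (e p) :=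
      contMDiffAt_extChartAt' (by simpa using hps)
    have hm : ContMDiff 𝓘(ℝ, E) 𝓘(ℝ, E) ∞ (fun x : G => e p * x) := contMDiff_mul_left
    have hc' : ContMDiffAt 𝓘(ℝ, E) 𝓘(ℝ, E) ∞ (fun x : G => chartOne E (e p * x)) 1 :=
      ContMDiffAt.comp (g := chartOne E) (f := fun x => e p * x) 1
        (by rw [mul_one]; exact hc) hm.contMDiffAt
    have e1 := mfderiv_comp_apply_of_eq (I := 𝓘(ℝ, E)) (I' := 𝓘(ℝ, E)) (I'' := 𝓘(ℝ, E))
      (g := chartOne E) (f := fun x : G => e p * x) (x := 1) (y := e p)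
      (hc.mdifferentiableAt (by simp)) (hm.contMDiffAt.mdifferentiableAt (by simp)) (by simp) w
    have e2 := mfderiv_comp_apply_of_eq (I := 𝓘(ℝ, E)) (I' := 𝓘(ℝ, E)) (I'' := 𝓘(ℝ, E))
      (g := fun x : G => chartOne E (e p * x)) (f := e) (x := chartOne E (1 : G)) (y := 1)
      (hc'.mdifferentiableAt (by simp)) (he.contMDiffAt.mdifferentiableAt (by simp)) h1 w
    have e3 : fderiv ℝ (fun q => chartOne E (e p * e q)) (chartOne E (1 : G)) w =
        mfderiv 𝓘(ℝ, E) 𝓘(ℝ, E) (fun x : G => chartOne E (e p * x)) 1 w := by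
      rw [← mfderiv_eq_fderiv]
      refine e2.trans ?_
      congr 1
      exact congrArg (fun L : E →L[ℝ] E => L w) hd
    exact (e3.trans e1).symm
  rw [lieB_eq_lieBracket, Filter.EventuallyEq.lieBracket_vectorField_eq (key u) (key v)]
  have hi : ∀ w : E, fderiv ℝ (fun q => chartOne E (e (chartOne E (1 : G)) * e q))
      (chartOne E (1 : G)) w = w := by
    intro w
    have h2 := leftLog_eq_fderiv (E := E) (he.contMDiffAt (x := chartOne E (1 : G)))
    rw [leftLog_param he hce h1] at h2
    simp only [h1, inv_one, one_mul] at h2 ⊢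
    rw [← h2]
    rfl
  rw [lieBracket, hi, hi]

omit [FiniteDimensional ℝ E] in
theorem eventually_param_chartOne {e : E → G}
    (hes : ∀ᶠ p in 𝓝 (chartOne E (1 : G)), e p = (extChartAt 𝓘(ℝ, E) (1 : G)).symm p) :
    ∀ᶠ z in 𝓝 (1 : G), e (chartOne E z) = z ∧
      ContMDiffAt 𝓘(ℝ, E) 𝓘(ℝ, E) ∞ (chartOne E : G → E) z := by
  have : IsManifold 𝓘(ℝ, E) ∞ G := inferInstance
  have hs := extChartAt_source_mem_nhds (I := 𝓘(ℝ, E)) (1 : G)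
  have hcont : Filter.Tendsto (chartOne E) (𝓝 (1 : G)) (𝓝 (chartOne E (1 : G))) :=
    (contMDiffAt_chartOne (E := E) (G := G)).continuousAt
  filter_upwards [hs, hcont.eventually hes] with z hz hz2
  refine ⟨?_, contMDiffAt_extChartAt' (by simpa using hz)⟩
  rw [hz2]
  exact (extChartAt 𝓘(ℝ, E) (1 : G)).left_inv hz

omit [FiniteDimensional ℝ E] in
/-- The Maurer-Cartan equation for the parametrisation of `G` by the chart at the identity. -/
theorem fderiv_leftLog_param {e : E → G} (he : ContMDiff 𝓘(ℝ, E) 𝓘(ℝ, E) ∞ e)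
    (hes : ∀ᶠ p in 𝓝 (chartOne E (1 : G)), e p = (extChartAt 𝓘(ℝ, E) (1 : G)).symm p)
    (hce : ∀ᶠ p in 𝓝 (chartOne E (1 : G)), chartOne E (e p) = p) (h1 : e (chartOne E (1 : G)) = 1)
    (u v : E) :
    fderiv ℝ (leftLog E e) (chartOne E (1 : G)) u v -
      fderiv ℝ (leftLog E e) (chartOne E (1 : G)) v u = -lieB E G u v := by
  have : IsManifold 𝓘(ℝ, E) ∞ G := inferInstance
  set c := chartOne E (1 : G) with hc
  set X : E → E → E := fun w p => fderiv ℝ (fun q => chartOne E (e p * e q)) c w with hX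
  have hXd : ∀ w, DifferentiableAt ℝ (X w) c := by
    intro w
    have : ContDiffAt ℝ ∞ (fun p => fderiv ℝ (fun q => chartOne E (e p * e q)) c) c := by
      refine ContDiffAt.fderiv (n := ∞) (f := fun p q => chartOne E (e p * e q))
        (g := fun _ => c) ?_ contDiffAt_const (by simp)
      refine contDiffAt_chartOne_comp (f := fun z : E × E => e z.1 * e z.2) ?_ (by simp [h1])
      exact ((he.comp contDiff_fst.contMDiff).mul (he.comp contDiff_snd.contMDiff)).contMDiffAt
    exact ((this.clm_apply contDiffAt_const).differentiableAt (by simp))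
  have hsec := eventually_param_chartOne hes
  -- The Maurer-Cartan form is constant on the left-invariant field `X w`: near the base point, `e`
  -- of the chart of `e p * e q` is `e p * e q`, and the factor `e p` drops out.
  have hinv : ∀ w, ∀ᶠ p in 𝓝 c, leftLog E e p (X w p) = w := by
    intro w
    have hcont : Filter.Tendsto e (𝓝 c) (𝓝 (1 : G)) := h1 ▸ he.continuous.tendsto c
    filter_upwards [hcont.eventually hsec.eventually_nhds, hce] with p hp hpe
    have hq : Filter.Tendsto (fun q => e p * e q) (𝓝 c) (𝓝 (e p)) := by
      have := (contMDiffAt_translate (e p) (he.contMDiffAt (x := c))).continuousAt.tendsto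
      simpa only [h1, mul_one] using this
    have hchart : ContMDiffAt 𝓘(ℝ, E) 𝓘(ℝ, E) ∞ (chartOne E : G → E) (e p) :=
      hp.self_of_nhds.2
    have hφ : ContDiffAt ℝ ∞ (fun q => chartOne E (e p * e q)) c := by
      refine (ContMDiffAt.comp (g := chartOne E) (f := fun q => e p * e q) c ?_
        (contMDiffAt_translate _ he.contMDiffAt)).contDiffAt
      rw [h1, mul_one]
      exact hchart
    have hφc : chartOne E (e p * e c) = p := by rw [h1, mul_one, hpe]
    have h2 := leftLog_comp (g := e) (φ := fun q => chartOne E (e p * e q)) he.contMDiffAt hφ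
    have h3 : (fun q => e (chartOne E (e p * e q))) =ᶠ[𝓝 c] fun q => e p * e q :=
      (hq.eventually hp).mono fun q hq => hq.1
    rw [leftLog_congr h3, leftLog_const_mul, leftLog_param he hce h1, hφc] at h2
    exact (DFunLike.congr_fun h2 w).symm
  -- Differentiate this constancy at `c`, where the Maurer-Cartan form is the identity.
  have hd : ∀ w z, fderiv ℝ (leftLog E e) c z w = -fderiv ℝ (X w) c z := by
    intro w z
    have hl : DifferentiableAt ℝ (leftLog E e) c :=
      (contDiff_leftLog he).contDiffAt.differentiableAt (by simp)
    have h4 : HasFDerivAt (fun p => leftLog E e p (X w p)) _ c :=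
      hl.hasFDerivAt.clm_apply (hXd w).hasFDerivAt
    have h5 : (fun p => leftLog E e p (X w p)) =ᶠ[𝓝 c] fun _ => w := hinv w
    have h6 := h4.fderiv
    rw [h5.fderiv_eq, leftLog_param he hce h1] at h6
    have hw : X w c = w := by
      have := (hinv w).self_of_nhds
      rwa [leftLog_param he hce h1] at this
    have := DFunLike.congr_fun h6 z
    simp [hw] at this
    rw [eq_neg_iff_add_eq_zero, add_comm]
    exact this.symm
  rw [hd, hd, lieB_eq_fderiv he hes hce h1]
  simp only [hX]
  abel

theorem fderiv_apply_clm {V W : Type*} [NormedAddCommGroup V] [NormedSpace ℝ V]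
    [NormedAddCommGroup W] [NormedSpace ℝ W] {α : F → V →L[ℝ] W} {x : F}
    (hα : DifferentiableAt ℝ α x) (u : F) (v : V) :
    fderiv ℝ (fun y => α y v) x u = fderiv ℝ α x u v := by
  rw [fderiv_clm_apply hα (differentiableAt_const v)]
  simp

theorem two_le_infty : (2 : WithTop ℕ∞) ≤ ∞ :=
  WithTop.coe_le_coe.2 (le_top : (2 : ℕ∞) ≤ ⊤)

/-- Naturality of the exterior derivative of vector valued one-forms. -/
theorem fderiv_pullback_sub {V : Type*} [NormedAddCommGroup V] [NormedSpace ℝ V]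
    {α : F → F →L[ℝ] V} {φ : F' → F} {x : F'} (hα : DifferentiableAt ℝ α (φ x))
    (hφ : ContDiffAt ℝ ∞ φ x) (u v : F') :
    fderiv ℝ (fun y => (α (φ y)).comp (fderiv ℝ φ y)) x u v -
      fderiv ℝ (fun y => (α (φ y)).comp (fderiv ℝ φ y)) x v u =
    fderiv ℝ α (φ x) (fderiv ℝ φ x u) (fderiv ℝ φ x v) -
      fderiv ℝ α (φ x) (fderiv ℝ φ x v) (fderiv ℝ φ x u) := by
  have h1 : HasFDerivAt (fun y => α (φ y)) _ x :=
    hα.hasFDerivAt.comp x (hφ.differentiableAt (by simp)).hasFDerivAt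
  have h2 : DifferentiableAt ℝ (fderiv ℝ φ) x :=
    (hφ.fderiv_right (m := ∞) (by simp)).differentiableAt (by simp)
  have h3 := (h1.clm_comp h2.hasFDerivAt).fderiv
  have hs : fderiv ℝ (fderiv ℝ φ) x u v = fderiv ℝ (fderiv ℝ φ) x v u :=
    (hφ.isSymmSndFDerivAt (by simpa using two_le_infty)) u v
  rw [h3]
  simp [hs]

/-- The Maurer-Cartan equation. -/
theorem fderiv_leftLog_sub {g : F → G} (hg : ContMDiff 𝓘(ℝ, F) 𝓘(ℝ, E) ∞ g) (x u v : F) :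
    fderiv ℝ (leftLog E g) x u v - fderiv ℝ (leftLog E g) x v u =
      -lieB E G (leftLog E g x u) (leftLog E g x v) := by
  obtain ⟨e, he, hes, hce, h1⟩ := exists_param E G
  have hφ : ContDiffAt ℝ ∞ (fun y => chartOne E ((g x)⁻¹ * g y)) x :=
    contDiffAt_chartOne_comp (contMDiffAt_translate _ hg.contMDiffAt) (by simp)
  have hsec := eventually_param_chartOne hes
  have hcont : Filter.Tendsto (fun y => (g x)⁻¹ * g y) (𝓝 x) (𝓝 (1 : G)) := by
    have := (contMDiffAt_translate (g x)⁻¹ (hg.contMDiffAt (x := x))).continuousAt.tendsto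
    simpa only [inv_mul_cancel] using this
  have hφx : chartOne E ((g x)⁻¹ * g x) = chartOne E (1 : G) := by simp
  -- Near `x`, `g` is `g x` times `e ∘ φ` with `φ` the chart of `(g x)⁻¹ * g`. So its logarithmic
  -- derivative is a pullback of that of `e`, and naturality of `d` transports the equation.
  have heq : leftLog E g =ᶠ[𝓝 x] fun y =>
      (leftLog E e (chartOne E ((g x)⁻¹ * g y))).comp
        (fderiv ℝ (fun y => chartOne E ((g x)⁻¹ * g y)) y) := by
    filter_upwards [(hcont.eventually hsec).eventually_nhds] with y hy
    have h2 := leftLog_comp (g := e) (φ := fun y => chartOne E ((g x)⁻¹ * g y)) (x := y)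
      he.contMDiffAt (ContMDiffAt.comp (g := chartOne E) (f := fun z => (g x)⁻¹ * g z) y
        hy.self_of_nhds.2 (contMDiffAt_translate _ hg.contMDiffAt)).contDiffAt
    rw [← h2, ← leftLog_const_mul (g x)⁻¹ g]
    exact (leftLog_congr (hy.mono fun z hz => hz.1)).symm
  have heq0 : leftLog E g x = fderiv ℝ (fun y => chartOne E ((g x)⁻¹ * g y)) x := by
    refine heq.self_of_nhds.trans ?_
    dsimp only
    rw [hφx, leftLog_param he hce h1, ContinuousLinearMap.id_comp]
  rw [heq.fderiv_eq, fderiv_pullback_sub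
    ((contDiff_leftLog he).contDiffAt.differentiableAt (by simp)) hφ, hφx,
    fderiv_leftLog_param he hes hce h1, heq0]

end LieBracket

/-! ### The adjoint action: smoothness, derivative, compatibility with the bracket -/

section AdjointCalculus

variable {E : Type*} [NormedAddCommGroup E] [NormedSpace ℝ E] [FiniteDimensional ℝ E]
  {G : Type*} [TopologicalSpace G] [ChartedSpace E G] [Group G] [LieGroup 𝓘(ℝ, E) ∞ G]
  {F : Type*} [NormedAddCommGroup F] [NormedSpace ℝ F]

/-- The map `e` has logarithmic derivative the identity at the base point, so `Ad c` is the
logarithmic derivative there of `c e c⁻¹`. The same device proves the other identities for `Ad`. -/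
theorem Ad_mul (a b : G) : Ad E (a * b) = (Ad E a).comp (Ad E b) := by
  obtain ⟨e, he, -, hce, h1⟩ := exists_param E G
  have h := leftLog_conj (a * b) (he.contMDiffAt (x := chartOne E (1 : G)))
  have hb := leftLog_conj b (he.contMDiffAt (x := chartOne E (1 : G)))
  have hab := leftLog_conj (g := fun y => b * e y * b⁻¹) a
    (((contMDiff_conj b).comp he).contMDiffAt (x := chartOne E (1 : G)))
  rw [leftLog_param he hce h1, ContinuousLinearMap.comp_id] at h hb
  rw [← h, ← hb, ← hab]
  congr 1
  ext y
  group

@[simp]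
theorem Ad_one : Ad E (1 : G) = ContinuousLinearMap.id ℝ E := by
  obtain ⟨e, he, -, hce, h1⟩ := exists_param E G
  have h := leftLog_conj 1 (he.contMDiffAt (x := chartOne E (1 : G)))
  rw [leftLog_param he hce h1, ContinuousLinearMap.comp_id] at h
  rw [← h, ← leftLog_param he hce h1]
  simp

theorem Ad_mul_apply (a b : G) (v : E) : Ad E (a * b) v = Ad E a (Ad E b v) := by
  rw [Ad_mul]
  rfl

@[simp]
theorem Ad_Ad_inv_apply (a : G) (v : E) : Ad E a (Ad E a⁻¹ v) = v := by
  rw [← Ad_mul_apply]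
  simp

omit [FiniteDimensional ℝ E] in
theorem leftLog_inv {g : F → G} {x : F} (hg : ContMDiffAt 𝓘(ℝ, F) 𝓘(ℝ, E) ∞ g x) :
    leftLog E (fun y => (g y)⁻¹) x = -(Ad E (g x)).comp (leftLog E g x) := by
  have h := leftLog_mul hg hg.inv
  simp only [mul_inv_cancel, leftLog_const, inv_inv] at h
  exact (neg_eq_of_add_eq_zero_right h.symm).symm

/-- `Ad (g x)` is the `E`-part of the logarithmic derivative of `(p, x) ↦ e(p)g(x)⁻¹`, which is
jointly smooth. -/
theorem contDiff_Ad {g : F → G} (hg : ContMDiff 𝓘(ℝ, F) 𝓘(ℝ, E) ∞ g) :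
    ContDiff ℝ ∞ (fun x => Ad E (g x)) := by
  obtain ⟨e, he, -, hce, h1⟩ := exists_param E G
  have hK : ContMDiff 𝓘(ℝ, E × F) 𝓘(ℝ, E) ∞ (fun z : E × F => e z.1 * (g z.2)⁻¹) :=
    (he.comp contDiff_fst.contMDiff).mul (hg.comp contDiff_snd.contMDiff).inv
  have h : (fun x => Ad E (g x)) = fun x =>
      (leftLog E (fun z : E × F => e z.1 * (g z.2)⁻¹) (chartOne E (1 : G), x)).comp
        (ContinuousLinearMap.inl ℝ E F) := by
    ext x w
    rw [ContinuousLinearMap.comp_apply, ContinuousLinearMap.inl_apply, leftLog_prod hK.contMDiffAt,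
      map_zero, add_zero]
    dsimp only
    rw [leftLog_mul_const _ he.contMDiffAt, leftLog_param he hce h1]
    simp
  rw [h]
  exact ((contDiff_leftLog hK).comp (contDiff_const.prodMk contDiff_id)).clm_comp contDiff_const

/-- Apply Maurer-Cartan to `K(p, y) = e(p)g(y)` on `(0, v)` and `(w, 0)`. On `(w, 0)` the form of
`K` at `(c, y)` is `Ad(g(y)⁻¹)w`; on `(0, v)` it does not depend on `p`, so one of the two
derivatives vanishes. -/
theorem fderiv_Ad_inv {g : F → G} (hg : ContMDiff 𝓘(ℝ, F) 𝓘(ℝ, E) ∞ g) (x v : F) (w : E) :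
    fderiv ℝ (fun y => Ad E (g y)⁻¹) x v w = -lieB E G (leftLog E g x v) (Ad E (g x)⁻¹ w) := by
  obtain ⟨e, he, -, hce, h1⟩ := exists_param E G
  set c := chartOne E (1 : G)
  set K : E × F → G := fun z : E × F => e z.1 * g z.2 with hKdef
  have hK : ContMDiff 𝓘(ℝ, E × F) 𝓘(ℝ, E) ∞ K :=
    (he.comp contDiff_fst.contMDiff).mul (hg.comp contDiff_snd.contMDiff)
  have hd : DifferentiableAt ℝ (leftLog E K) (c, x) :=
    (contDiff_leftLog hK).contDiffAt.differentiableAt (by simp)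
  have h2 : ∀ p y (u : F), leftLog E K (p, y) (0, u) = leftLog E g y u := by
    intro p y u
    rw [leftLog_prod hK.contMDiffAt, map_zero, zero_add]
    simp only [hKdef, leftLog_const_mul]
  have h3 : ∀ y, leftLog E K (c, y) (w, 0) = Ad E (g y)⁻¹ w := by
    intro y
    rw [leftLog_prod hK.contMDiffAt, map_zero, add_zero]
    simp only [hKdef]
    rw [leftLog_mul_const _ he.contMDiffAt, leftLog_param he hce h1]
    rfl
  have h4 := fderiv_leftLog_sub hK (c, x) (0, v) (w, 0)
  rw [h2, h3] at h4
  have h5 : fderiv ℝ (leftLog E K) (c, x) (w, 0) (0, v) = 0 := by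
    have h6 := (HasFDerivAt.comp (g := leftLog E K) c hd.hasFDerivAt
      (hasFDerivAt_prodMk_left c x)).clm_apply (hasFDerivAt_const ((0 : E), v) c)
    have h7 := h6.fderiv
    have h8 : (fun y => (leftLog E K ∘ fun z => (z, x)) y ((0 : E), v)) =
        fun _ => leftLog E g x v := funext fun y => h2 y x v
    rw [h8] at h7
    simpa using (DFunLike.congr_fun h7 w).symm
  have h6 : fderiv ℝ (leftLog E K) (c, x) (0, v) (w, 0) =
      fderiv ℝ (fun y => Ad E (g y)⁻¹) x v w := by
    have h6 := (HasFDerivAt.comp (g := leftLog E K) x hd.hasFDerivAt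
      (hasFDerivAt_prodMk_right c x)).clm_apply (hasFDerivAt_const (w, (0 : F)) x)
    have h7 := h6.fderiv
    have h8 : (fun y => (leftLog E K ∘ fun z => (c, z)) y (w, (0 : F))) =
        fun y => Ad E (g y)⁻¹ w := funext fun y => h3 y
    rw [h8] at h7
    rw [← fderiv_apply_clm ((contDiff_Ad hg.inv).contDiffAt.differentiableAt (by simp)), h7]
    simp
  rw [← h6, ← h4, h5, sub_zero]

/-- Compare the Maurer-Cartan equations of `e` and of `c e c⁻¹`. -/
theorem Ad_lieB (c : G) (u v : E) :
    Ad E c (lieB E G u v) = lieB E G (Ad E c u) (Ad E c v) := by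
  obtain ⟨e, he, -, hce, h1⟩ := exists_param E G
  have h2 := fderiv_leftLog_sub he (chartOne E (1 : G)) u v
  have h3 := fderiv_leftLog_sub (g := fun y => c * e y * c⁻¹) ((contMDiff_conj c).comp he)
    (chartOne E (1 : G)) u v
  have h4 : leftLog E (fun y => c * e y * c⁻¹) = fun y => (Ad E c).comp (leftLog E e y) :=
    funext fun y => leftLog_conj c he.contMDiffAt
  have hd : DifferentiableAt ℝ (leftLog E e) (chartOne E (1 : G)) :=
    (contDiff_leftLog he).contDiffAt.differentiableAt (by simp)
  rw [h4, fderiv_clm_comp (differentiableAt_const _) hd, leftLog_param he hce h1] at h3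
  rw [leftLog_param he hce h1] at h2
  simp at h2 h3
  rw [← map_sub, h2] at h3
  simpa [leftLog_param he hce h1] using h3

instance : LieGroup 𝓘(ℝ, E) (minSmoothness ℝ 3) G :=
  LieGroup.of_le (n := ∞) (by
    rw [minSmoothness_of_isRCLikeNormedField]
    exact WithTop.coe_le_coe.2 (le_top : (3 : ℕ∞) ≤ ⊤))

theorem lieB_add_left (u v w : E) : lieB E G (u + v) w = lieB E G u w + lieB E G v w :=
  add_lie (L := GroupLieAlgebra 𝓘(ℝ, E) G) (M := GroupLieAlgebra 𝓘(ℝ, E) G) u v w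

theorem lieB_add_right (u v w : E) : lieB E G u (v + w) = lieB E G u v + lieB E G u w :=
  lie_add (L := GroupLieAlgebra 𝓘(ℝ, E) G) (M := GroupLieAlgebra 𝓘(ℝ, E) G) u v w

theorem lieB_smul_left (c : ℝ) (u v : E) : lieB E G (c • u) v = c • lieB E G u v :=
  smul_lie (R := ℝ) (L := GroupLieAlgebra 𝓘(ℝ, E) G) (M := GroupLieAlgebra 𝓘(ℝ, E) G) c u v

theorem lieB_smul_right (c : ℝ) (u v : E) : lieB E G u (c • v) = c • lieB E G u v :=
  lie_smul (R := ℝ) (L := GroupLieAlgebra 𝓘(ℝ, E) G) (M := GroupLieAlgebra 𝓘(ℝ, E) G) c u v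

theorem lieB_skew (u v : E) : -lieB E G v u = lieB E G u v :=
  lie_skew (L := GroupLieAlgebra 𝓘(ℝ, E) G) u v

theorem lieB_jacobi (u v w : E) :
    lieB E G u (lieB E G v w) + lieB E G v (lieB E G w u) + lieB E G w (lieB E G u v) = 0 :=
  lie_jacobi (L := GroupLieAlgebra 𝓘(ℝ, E) G) u v w

variable (E G) in
/-- The Lie bracket as a continuous bilinear map. -/
def lieCLM : E →L[ℝ] E →L[ℝ] E :=
  LinearMap.toContinuousLinearMap
    { toFun := fun u => LinearMap.toContinuousLinearMap
        { toFun := fun v => lieB E G u v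
          map_add' := lieB_add_right u
          map_smul' := fun c v => lieB_smul_right c u v }
      map_add' := fun u v => by
        ext w
        exact lieB_add_left u v w
      map_smul' := fun c u => by
        ext w
        exact lieB_smul_left c u w }

@[simp]
theorem lieCLM_apply (u v : E) : lieCLM E G u v = lieB E G u v := rfl

end AdjointCalculus

/-! ### Curvature of one-forms on normed spaces -/

section Curvature

variable {E : Type*} [NormedAddCommGroup E] [NormedSpace ℝ E] [FiniteDimensional ℝ E]
  {G : Type*} [TopologicalSpace G] [ChartedSpace E G] [Group G] [LieGroup 𝓘(ℝ, E) ∞ G]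
  {F F' : Type*} [NormedAddCommGroup F] [NormedSpace ℝ F] [NormedAddCommGroup F'] [NormedSpace ℝ F']

variable (G) in
/-- The curvature `dα + ½[α, α]` of a Lie algebra valued one-form on a normed space. -/
def curv (α : F → F →L[ℝ] E) (x : F) : F →L[ℝ] F →L[ℝ] E :=
  fderiv ℝ α x - (fderiv ℝ α x).flip + (lieCLM E G).bilinearComp (α x) (α x)

theorem curv_apply (α : F → F →L[ℝ] E) (x u v : F) :
    curv G α x u v = fderiv ℝ α x u v - fderiv ℝ α x v u + lieB E G (α x u) (α x v) := by
  simp [curv]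

theorem curv_congr {α β : F → F →L[ℝ] E} {x : F} (h : α =ᶠ[𝓝 x] β) :
    curv G α x = curv G β x := by
  unfold curv
  rw [h.fderiv_eq, h.eq_of_nhds]

omit [FiniteDimensional ℝ E] in
theorem contDiff_flip {V W : Type*} [NormedAddCommGroup V] [NormedSpace ℝ V]
    [NormedAddCommGroup W] [NormedSpace ℝ W] {β : F → V →L[ℝ] W →L[ℝ] E} (hβ : ContDiff ℝ ∞ β) :
    ContDiff ℝ ∞ (fun x => (β x).flip) := by
  have h : IsBoundedLinearMap ℝ (fun b : V →L[ℝ] W →L[ℝ] E => b.flip) :=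
    { map_add := fun _ _ => rfl
      map_smul := fun _ _ => rfl
      bound := ⟨1, one_pos, fun b => by simp⟩ }
  have h' : ContDiff ℝ ∞ (fun b : V →L[ℝ] W →L[ℝ] E => b.flip) := IsBoundedLinearMap.contDiff h
  exact h'.comp hβ

theorem contDiff_curv {α : F → F →L[ℝ] E} (hα : ContDiff ℝ ∞ α) : ContDiff ℝ ∞ (curv G α) := by
  have h1 : ContDiff ℝ ∞ (fderiv ℝ α) := hα.fderiv_right (by simp)
  have h2 : ContDiff ℝ ∞ (fun x => (fderiv ℝ α x).flip) :=
    contDiff_flip h1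
  have h3 : ContDiff ℝ ∞ (fun x => ((lieCLM E G).comp (α x)).flip) :=
    contDiff_flip (contDiff_const.clm_comp hα)
  have h4 : ContDiff ℝ ∞ (fun x => (((lieCLM E G).comp (α x)).flip.comp (α x)).flip) :=
    contDiff_flip (h3.clm_comp hα)
  have h5 : curv G α = fun x => fderiv ℝ α x - (fderiv ℝ α x).flip +
      (((lieCLM E G).comp (α x)).flip.comp (α x)).flip := by
    ext x u v
    simp [curv]
  rw [h5]
  exact (h1.sub h2).add h4

theorem curv_pullback {α : F → F →L[ℝ] E} {φ : F' → F} {x : F'} (hα : DifferentiableAt ℝ α (φ x))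
    (hφ : ContDiffAt ℝ ∞ φ x) (u v : F') :
    curv G (fun y => (α (φ y)).comp (fderiv ℝ φ y)) x u v =
      curv G α (φ x) (fderiv ℝ φ x u) (fderiv ℝ φ x v) := by
  rw [curv_apply, curv_apply, fderiv_pullback_sub hα hφ]
  rfl

/-- Behaviour of the curvature under a gauge transformation. -/
theorem curv_gauge {α : F → F →L[ℝ] E} {x : F} (hα : DifferentiableAt ℝ α x) {g : F → G}
    (hg : ContMDiff 𝓘(ℝ, F) 𝓘(ℝ, E) ∞ g) (u v : F) :
    curv G (fun y => (Ad E (g y)⁻¹).comp (α y) + leftLog E g y) x u v =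
      Ad E (g x)⁻¹ (curv G α x u v) := by
  have hA : DifferentiableAt ℝ (fun y => Ad E (g y)⁻¹) x :=
    (contDiff_Ad hg.inv).contDiffAt.differentiableAt (by simp)
  have hl : DifferentiableAt ℝ (leftLog E g) x :=
    (contDiff_leftLog hg).contDiffAt.differentiableAt (by simp)
  have hd : ∀ a b, fderiv ℝ (fun y => (Ad E (g y)⁻¹).comp (α y) + leftLog E g y) x a b =
      Ad E (g x)⁻¹ (fderiv ℝ α x a b) - lieB E G (leftLog E g x a) (Ad E (g x)⁻¹ (α x b)) +
        fderiv ℝ (leftLog E g) x a b := by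
    intro a b
    rw [fderiv_fun_add (hA.clm_comp hα) hl, fderiv_clm_comp hA hα]
    simp [fderiv_Ad_inv hg, sub_eq_add_neg]
  -- Maurer-Cartan removes the part involving only `g`; the terms from differentiating `Ad(g⁻¹)`
  -- cancel the mixed brackets.
  have hm := fderiv_leftLog_sub hg x u v
  rw [sub_eq_iff_eq_add] at hm
  rw [curv_apply, curv_apply, hd, hd, hm]
  simp only [add_apply, ContinuousLinearMap.comp_apply, lieB_add_left, lieB_add_right, map_add,
    map_sub, Ad_lieB]
  rw [← lieB_skew (leftLog E g x v)]
  abel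

/-- The Bianchi identity. -/
theorem fderiv_curv_cyclic {α : F → F →L[ℝ] E} (hα : ContDiff ℝ ∞ α) (x u v w : F) :
    fderiv ℝ (curv G α) x w u v + fderiv ℝ (curv G α) x u v w + fderiv ℝ (curv G α) x v w u =
      -(lieB E G (α x w) (curv G α x u v) + lieB E G (α x u) (curv G α x v w) +
        lieB E G (α x v) (curv G α x w u)) := by
  have hd : DifferentiableAt ℝ α x := hα.contDiffAt.differentiableAt (by simp)
  have h1 : ContDiff ℝ ∞ (fderiv ℝ α) := hα.fderiv_right (by simp)
  have hd1 : DifferentiableAt ℝ (fderiv ℝ α) x := h1.contDiffAt.differentiableAt (by simp)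
  have hdc : DifferentiableAt ℝ (curv G α) x :=
    (contDiff_curv hα).contDiffAt.differentiableAt (by simp)
  have hs : ∀ a b, fderiv ℝ (fderiv ℝ α) x a b = fderiv ℝ (fderiv ℝ α) x b a := fun a b =>
    (hα.contDiffAt.isSymmSndFDerivAt (by simpa using two_le_infty)) a b
  have hk : ∀ a b c, fderiv ℝ (curv G α) x a b c =
      fderiv ℝ (fderiv ℝ α) x a b c - fderiv ℝ (fderiv ℝ α) x a c b +
        (lieB E G (fderiv ℝ α x a b) (α x c) + lieB E G (α x b) (fderiv ℝ α x a c)) := by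
    intro a b c
    have e1 : HasFDerivAt (fun y => fderiv ℝ α y b c) _ x :=
      ((hd1.hasFDerivAt.clm_apply (hasFDerivAt_const b x)).clm_apply (hasFDerivAt_const c x))
    have e2 : HasFDerivAt (fun y => fderiv ℝ α y c b) _ x :=
      ((hd1.hasFDerivAt.clm_apply (hasFDerivAt_const c x)).clm_apply (hasFDerivAt_const b x))
    have e3 : HasFDerivAt (fun y => lieCLM E G (α y b) (α y c)) _ x :=
      (((lieCLM E G).hasFDerivAt.comp x
        (hd.hasFDerivAt.clm_apply (hasFDerivAt_const b x))).clm_apply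
        (hd.hasFDerivAt.clm_apply (hasFDerivAt_const c x)))
    have e4 : HasFDerivAt (fun y => curv G α y b c) _ x :=
      ((hdc.hasFDerivAt.clm_apply (hasFDerivAt_const b x)).clm_apply (hasFDerivAt_const c x))
    have e5 : (fun y => curv G α y b c) = fun y => fderiv ℝ α y b c - fderiv ℝ α y c b +
        lieCLM E G (α y b) (α y c) := funext fun y => curv_apply α y b c
    rw [e5] at e4
    have e6 := DFunLike.congr_fun (e4.unique ((e1.sub e2).add e3)) a
    simp at e6
    rw [e6]
    abel
  -- The second derivatives cancel in pairs by symmetry, and the double brackets on the right-hand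
  -- side vanish by Jacobi.
  rw [hk, hk, hk, hs v w, hs u w, hs u v]
  simp only [curv_apply, lieB_add_right, sub_eq_add_neg]
  have hneg : ∀ a b, lieB E G a (-b) = -lieB E G a b := fun a b => by
    rw [← neg_one_smul ℝ b, lieB_smul_right, neg_one_smul]
  have hj := lieB_jacobi (G := G) (α x w) (α x u) (α x v)
  simp only [hneg]
  rw [← lieB_skew (α x v) (fderiv ℝ α x w u), ← lieB_skew (α x w) (fderiv ℝ α x u v),
    ← lieB_skew (α x u) (fderiv ℝ α x v w)]
  rw [add_assoc] at hj
  rw [eq_neg_of_add_eq_zero_left hj]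
  abel

end Curvature

/-! ### Invariant polynomials and the alternating forms they define -/

section ChernWeilForms

variable {E : Type*} [NormedAddCommGroup E] [NormedSpace ℝ E] [FiniteDimensional ℝ E]
  {G : Type*} [TopologicalSpace G] [ChartedSpace E G] [Group G]
  {F : Type*} [NormedAddCommGroup F] [NormedSpace ℝ F]

omit [FiniteDimensional ℝ E] in
-- An alternating form is determined by its values on tuples of basis vectors. A linear left inverse
-- of this coefficient map recovers `β` from finitely many smooth functions.
theorem contDiff_alternating {ι V : Type*} [Finite ι] [Fintype ι] [NormedAddCommGroup V]
    [NormedSpace ℝ V] [FiniteDimensional ℝ V] [FiniteDimensional ℝ E] {β : F → E [⋀^ι]→L[ℝ] V}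
    (h : ∀ v, ContDiff ℝ ∞ (fun x => β x v)) : ContDiff ℝ ∞ β := by
  classical
  let b := Module.finBasis ℝ E
  let T : (E [⋀^ι]→L[ℝ] V) →ₗ[ℝ] ((ι → Fin (Module.finrank ℝ E)) → V) :=
    { toFun := fun η I => η (fun i => b (I i))
      map_add' := fun _ _ => rfl
      map_smul' := fun _ _ => rfl }
  have hT : LinearMap.ker T = ⊥ := by
    refine LinearMap.ker_eq_bot'.2 fun η hη => ?_
    refine ContinuousAlternatingMap.toAlternatingMap_injective ?_
    exact Module.Basis.ext_alternating b fun I _ => congrFun hη I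
  obtain ⟨S, hS⟩ := T.exists_leftInverse_of_injective hT
  have h1 : β = fun x => S.toContinuousLinearMap (T (β x)) :=
    funext fun x => (DFunLike.congr_fun hS (β x)).symm
  rw [h1]
  exact S.toContinuousLinearMap.contDiff.comp (contDiff_pi.2 fun I => h _)

theorem continuous_multilinear {ι V : Type*} [Fintype ι] [NormedAddCommGroup V] [NormedSpace ℝ V]
    (f : MultilinearMap ℝ (fun _ : ι => E) V) : Continuous f := by
  classical
  let b := Module.finBasis ℝ E
  have h : ∀ v : ι → E, f v = ∑ I : ι → Fin (Module.finrank ℝ E),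
      (∏ i, b.repr (v i) (I i)) • f (fun i => b (I i)) := by
    intro v
    conv_lhs => rw [show v = fun i => ∑ j, b.repr (v i) j • b j from
      funext fun i => (b.sum_repr (v i)).symm]
    rw [f.map_sum]
    exact Finset.sum_congr rfl fun I _ => f.map_smul_univ _ _
  rw [show (f : (ι → E) → V) = _ from funext h]
  have hc : ∀ j, Continuous fun w : E => b.repr w j := fun j =>
    ((b.coord j).toContinuousLinearMap).continuous
  refine continuous_finsetSum _ fun I _ => Continuous.smul ?_ continuous_const
  exact continuous_finsetProd _ fun i _ => (hc (I i)).comp (continuous_apply i)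

/-- An invariant polynomial as a continuous multilinear map. -/
def InvariantPolynomial.toContinuous {k : ℕ} (f : InvariantPolynomial E G k) :
    ContinuousMultilinearMap ℝ (fun _ : Fin k => E) ℝ :=
  ⟨f.toFun, continuous_multilinear f.toFun⟩

@[simp]
theorem InvariantPolynomial.toContinuous_apply {k : ℕ} (f : InvariantPolynomial E G k)
    (v : Fin k → E) : f.toContinuous v = f.toFun v := rfl

/-- Infinitesimal invariance. -/
theorem InvariantPolynomial.sum_lieB [LieGroup 𝓘(ℝ, E) ∞ G] {k : ℕ}
    (f : InvariantPolynomial E G k) (v : E) (w : Fin k → E) :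
    ∑ j, f.toFun (Function.update w j (lieB E G v (w j))) = 0 := by
  obtain ⟨e, he, -, hce, h1⟩ := exists_param E G
  have hd : ∀ i, HasFDerivAt (fun y => Ad E (e y)⁻¹ (w i)) _ (chartOne E (1 : G)) := fun i =>
    ((contDiff_Ad he.inv).contDiffAt.differentiableAt (by simp)).hasFDerivAt.clm_apply
      (hasFDerivAt_const (w i) _)
  have h2 := HasFDerivAt.multilinear_comp f.toContinuous hd
  -- Invariance makes this function constant; its derivative at the base point in direction `v` is
  -- minus the required sum.
  have h3 : (fun y => f.toContinuous fun i => Ad E (e y)⁻¹ (w i)) = fun _ => f.toFun w :=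
    funext fun y => f.invariant _ _
  rw [h3] at h2
  have h4 := DFunLike.congr_fun (h2.unique (hasFDerivAt_const _ _)) v
  simp only [sum_apply, ContinuousLinearMap.comp_apply, h1, inv_one, Ad_one,
    ContinuousMultilinearMap.toContinuousLinearMap_apply, add_apply,
    ContinuousLinearMap.flip_apply, zero_apply, map_zero, zero_add,
    fderiv_Ad_inv he, leftLog_param he hce h1, ContinuousLinearMap.id_apply,
    InvariantPolynomial.toContinuous_apply, f.toFun.map_update_neg, Finset.sum_neg_distrib,
    neg_eq_zero] at h4
  exact h4

/-- The values of a bilinear map on the consecutive pairs of a list of vectors. -/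
def pairs {k : ℕ} (Ω : F → F → E) (v : Fin (2 * k) → F) (i : Fin k) : E :=
  Ω (v ⟨2 * i, by omega⟩) (v ⟨2 * i + 1, by omega⟩)

omit [FiniteDimensional ℝ E] in
-- Each index is `2j` or `2j + 1` for a single `j`, so one vector enters one pair only, and
-- linearly. This reduces multilinearity of `pairsMultilinear` to that of `f`.
theorem exists_pairs_update {k : ℕ} [DecidableEq (Fin (2 * k))] (Ω : F →L[ℝ] F →L[ℝ] E)
    (v : Fin (2 * k) → F) (m : Fin (2 * k)) : ∃ (j : Fin k) (L : F →ₗ[ℝ] E),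
      ∀ x, pairs (fun a b => Ω a b) (Function.update v m x) =
        Function.update (pairs (fun a b => Ω a b) v) j (L x) := by
  obtain ⟨m, hm⟩ := m
  obtain ⟨j, rfl | rfl⟩ := Nat.even_or_odd' m
  · refine ⟨⟨j, by omega⟩, (Ω.flip (v ⟨2 * j + 1, by omega⟩) : F →ₗ[ℝ] E), fun x => ?_⟩
    ext ⟨i, hi⟩
    by_cases hij : i = j
    · subst hij
      simp [pairs]
    · have h1 : 2 * i + 1 ≠ 2 * j := by omega
      simp [pairs, hij, h1]
  · refine ⟨⟨j, by omega⟩, (Ω (v ⟨2 * j, by omega⟩) : F →ₗ[ℝ] E), fun x => ?_⟩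
    ext ⟨i, hi⟩
    by_cases hij : i = j
    · subst hij
      simp [pairs]
    · have h1 : 2 * i ≠ 2 * j + 1 := by omega
      simp [pairs, hij, h1]

/-- The multilinear map `v ↦ f(Ω(v₀, v₁), Ω(v₂, v₃), …)`. -/
def pairsMultilinear {k : ℕ} (f : MultilinearMap ℝ (fun _ : Fin k => E) ℝ)
    (Ω : F →L[ℝ] F →L[ℝ] E) : MultilinearMap ℝ (fun _ : Fin (2 * k) => F) ℝ where
  toFun v := f (pairs (fun a b => Ω a b) v)
  map_update_add' v m x y := by
    obtain ⟨j, L, h⟩ := exists_pairs_update Ω v m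
    simp only [h, map_add, f.map_update_add]
  map_update_smul' v m c x := by
    obtain ⟨j, L, h⟩ := exists_pairs_update Ω v m
    simp only [h, map_smul, f.map_update_smul]

/-- The alternating form `f(Ω, …, Ω)` for a bilinear `Ω`. -/
def cwForm {k : ℕ} (f : InvariantPolynomial E G k) (Ω : F →L[ℝ] F →L[ℝ] E) :
    F [⋀^Fin (2 * k)]→L[ℝ] ℝ :=
  { (1 / 2 ^ k : ℝ) • MultilinearMap.alternatization (pairsMultilinear f.toFun Ω) with
    cont := by
      have h : Continuous fun v : Fin (2 * k) → F =>
          (1 / 2 ^ k : ℝ) • ∑ σ : Equiv.Perm (Fin (2 * k)), Equiv.Perm.sign σ •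
            f.toContinuous (pairs (fun a b => Ω a b) (fun i => v (σ i))) := by
        apply Continuous.fun_const_smul
        apply continuous_finsetSum
        intro σ _
        have h2 : Continuous fun v : Fin (2 * k) → F =>
            pairs (fun a b => Ω a b) (fun i => v (σ i)) := continuous_pi fun i =>
          (Ω.continuous.comp (continuous_apply (σ ⟨2 * i, by omega⟩))).clm_apply
            (continuous_apply (σ ⟨2 * i + 1, by omega⟩))
        simp only [Units.smul_def]
        exact (f.toContinuous.cont.comp h2).fun_const_smul _
      convert h using 2 with v
      change (1 / 2 ^ k : ℝ) • MultilinearMap.alternatization (pairsMultilinear f.toFun Ω) v = _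
      rw [MultilinearMap.alternatization_apply]
      rfl }

theorem cwForm_apply {k : ℕ} (f : InvariantPolynomial E G k) (Ω : F →L[ℝ] F →L[ℝ] E)
    (v : Fin (2 * k) → F) : cwForm f Ω v =
      (1 / 2 ^ k : ℝ) * ∑ σ : Equiv.Perm (Fin (2 * k)), ((Equiv.Perm.sign σ : ℤ) : ℝ) *
        f.toFun (fun i : Fin k => Ω (v (σ ⟨2 * i, by omega⟩)) (v (σ ⟨2 * i + 1, by omega⟩))) := by
  change (1 / 2 ^ k : ℝ) • MultilinearMap.alternatization (pairsMultilinear f.toFun Ω) v = _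
  rw [MultilinearMap.alternatization_apply, smul_eq_mul]
  congr 1
  refine Finset.sum_congr rfl fun σ _ => ?_
  rw [Units.smul_def, zsmul_eq_mul]
  rfl

theorem contDiff_cwForm [FiniteDimensional ℝ F] {k : ℕ} (f : InvariantPolynomial E G k)
    {F' : Type*} [NormedAddCommGroup F'] [NormedSpace ℝ F']
    {Ω : F' → F →L[ℝ] F →L[ℝ] E} (hΩ : ContDiff ℝ ∞ Ω) :
    ContDiff ℝ ∞ (fun x => cwForm f (Ω x)) := by
  refine contDiff_alternating fun v => ?_
  simp only [cwForm_apply]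
  refine contDiff_const.mul (ContDiff.sum fun σ _ => contDiff_const.mul ?_)
  refine (f.toContinuous.contDiff).comp (contDiff_pi.2 fun i => ?_)
  exact (hΩ.clm_apply contDiff_const).clm_apply contDiff_const

end ChernWeilForms

/-! ### Alternating sums and closedness of the Chern-Weil forms -/

section ChernWeilClosed

variable {E : Type*} [NormedAddCommGroup E] [NormedSpace ℝ E]
  {G : Type*} [TopologicalSpace G] [ChartedSpace E G] [Group G]
  {F : Type*} [NormedAddCommGroup F] [NormedSpace ℝ F]

open Equiv

/-- A permutation of `{0, …, n}` is given by the image of `0` and a permutation of `{1, …, n}`. -/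
theorem sum_perm_fin_succ {X : Type*} {n : ℕ} (v : Fin (n + 1) → X) (T : (Fin (n + 1) → X) → ℝ) :
    ∑ i : Fin (n + 1), (-1) ^ (i : ℕ) * ∑ σ : Perm (Fin n), ((Perm.sign σ : ℤ) : ℝ) *
        T (Fin.cons (v i) (fun j => i.removeNth v (σ j))) =
      ∑ τ : Perm (Fin (n + 1)), ((Perm.sign τ : ℤ) : ℝ) * T (v ∘ τ) := by
  -- The second factor fixes `0` and permutes the successors; `cycleRange⁻¹` then moves `0` to `i`
  -- and the successors to the remaining indices in order, with sign `(-1)^i`.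
  let Ψ : Fin (n + 1) × Perm (Fin n) → Perm (Fin (n + 1)) := fun z =>
    z.1.cycleRange⁻¹ * Perm.decomposeFin.symm (0, z.2)
  have h0 : ∀ z, Ψ z 0 = z.1 := fun z => by
    simp [Ψ, Perm.mul_apply, Perm.inv_def]
  have hs : ∀ z j, Ψ z j.succ = z.1.succAbove (z.2 j) := fun z j => by
    simp [Ψ, Perm.mul_apply, Perm.inv_def]
  have hΨ : Function.Bijective Ψ := by
    rw [Fintype.bijective_iff_injective_and_card]
    refine ⟨fun z w h => ?_, by simp [Fintype.card_perm, Nat.factorial_succ]⟩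
    have h1 : z.1 = w.1 := by rw [← h0 z, ← h0 w, h]
    refine Prod.ext h1 (Equiv.ext fun j => ?_)
    have h2 : Ψ z j.succ = Ψ w j.succ := by rw [h]
    rw [hs, hs, h1] at h2
    exact Fin.succAbove_right_injective h2
  simp only [Finset.mul_sum]
  rw [← Fintype.sum_prod_type', ]
  refine Fintype.sum_bijective Ψ hΨ _ _ fun z => ?_
  have h1 : ((Perm.sign (Ψ z) : ℤ) : ℝ) = (-1) ^ (z.1 : ℕ) * ((Perm.sign z.2 : ℤ) : ℝ) := by
    simp [Ψ, Fin.sign_cycleRange, Perm.decomposeFin.symm_sign]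
  have h2 : (Fin.cons (v z.1) (fun j => z.1.removeNth v (z.2 j)) : Fin (n + 1) → X) = v ∘ Ψ z := by
    refine funext fun j => Fin.cases ?_ (fun j => ?_) j
    · simp [h0]
    · simp [hs, Fin.removeNth]
  rw [h1, h2, mul_assoc]

theorem sum_perm_comp {X : Type*} {n : ℕ} (v : Fin n → X) (T : (Fin n → X) → ℝ) (c : Perm (Fin n))
    (hc : Perm.sign c = 1) :
    ∑ τ : Perm (Fin n), ((Perm.sign τ : ℤ) : ℝ) * T ((v ∘ τ) ∘ c) =
      ∑ τ : Perm (Fin n), ((Perm.sign τ : ℤ) : ℝ) * T (v ∘ τ) := by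
  refine Fintype.sum_equiv (Equiv.mulRight c) _ _ fun τ => ?_
  simp only [Equiv.coe_mulRight, Perm.sign_mul, hc, mul_one]
  rfl

omit [NormedAddCommGroup F] [NormedSpace ℝ F] in
/-- An alternating sum over all permutations does not change if an expression in three of the
arguments is replaced by another one with the same cyclic sums. -/
theorem sum_perm_update_congr {k : ℕ} (f : MultilinearMap ℝ (fun _ : Fin k => E) ℝ)
    (Ω : F → F → E) (Θ Θ' : F → F → F → E)
    (h : ∀ u v w, Θ w u v + Θ u v w + Θ v w u = Θ' w u v + Θ' u v w + Θ' v w u)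
    (v : Fin (2 * k + 1) → F) (j : Fin k) :
    ∑ τ : Perm (Fin (2 * k + 1)), ((Perm.sign τ : ℤ) : ℝ) *
      f (Function.update (pairs Ω (Fin.tail (v ∘ τ))) j
        (Θ ((v ∘ τ) 0) (Fin.tail (v ∘ τ) ⟨2 * j, by omega⟩)
          (Fin.tail (v ∘ τ) ⟨2 * j + 1, by omega⟩))) =
    ∑ τ : Perm (Fin (2 * k + 1)), ((Perm.sign τ : ℤ) : ℝ) *
      f (Function.update (pairs Ω (Fin.tail (v ∘ τ))) j
        (Θ' ((v ∘ τ) 0) (Fin.tail (v ∘ τ) ⟨2 * j, by omega⟩)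
          (Fin.tail (v ∘ τ) ⟨2 * j + 1, by omega⟩))) := by
  set b : Fin (2 * k + 1) := Fin.succ ⟨2 * j, by omega⟩ with hb
  set d : Fin (2 * k + 1) := Fin.succ ⟨2 * j + 1, by omega⟩ with hd
  have hb0 : b ≠ 0 := Fin.succ_ne_zero _
  have hd0 : d ≠ 0 := Fin.succ_ne_zero _
  have hbd : b ≠ d := by simp [hb, hd]
  -- The 3-cycle `0 → b → d → 0`: it is even and touches no pair other than the `j`-th.
  let c : Perm (Fin (2 * k + 1)) := swap 0 b * swap b d
  have hc0 : c 0 = b := by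
    simp only [c, Perm.mul_apply, swap_apply_of_ne_of_ne hb0.symm hd0.symm, swap_apply_left]
  have hcb : c b = d := by
    simp only [c, Perm.mul_apply, swap_apply_left, swap_apply_of_ne_of_ne hd0 hbd.symm]
  have hcd : c d = 0 := by
    simp only [c, Perm.mul_apply, swap_apply_right]
  have hc : Perm.sign c = 1 := by
    simp only [c, Perm.sign_mul, Perm.sign_swap hb0.symm, Perm.sign_swap hbd]
    rfl
  have hother : ∀ (z : Fin (2 * k + 1) → F) (i : Fin k), i ≠ j →
      pairs Ω (Fin.tail (z ∘ c)) i = pairs Ω (Fin.tail z) i := by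
    intro z i hij
    have hij' : (i : ℕ) ≠ j := fun h => hij (Fin.ext h)
    have hfix : ∀ m : Fin (2 * k), (m : ℕ) ≠ 2 * j → (m : ℕ) ≠ 2 * j + 1 → c m.succ = m.succ := by
      intro m h1 h2
      have e0 : m.succ ≠ 0 := Fin.succ_ne_zero _
      have e1 : m.succ ≠ b := fun h => h1 (by simpa [hb, Fin.ext_iff] using h)
      have e2 : m.succ ≠ d := fun h => h2 (by simpa [hd, Fin.ext_iff] using h)
      simp only [c, Perm.mul_apply, swap_apply_of_ne_of_ne e1 e2, swap_apply_of_ne_of_ne e0 e1]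
    simp only [pairs, Fin.tail, Function.comp_apply]
    rw [hfix _ (by simp; omega) (by simp; omega), hfix _ (by simp; omega) (by simp; omega)]
  have hupd : ∀ (z : Fin (2 * k + 1) → F) (y : E),
      Function.update (pairs Ω (Fin.tail (z ∘ c))) j y =
        Function.update (pairs Ω (Fin.tail z)) j y := by
    intro z y
    ext i
    by_cases hij : i = j
    · subst hij
      simp
    · simp [hij, hother z i hij]
  -- Reindexing by `1`, `c` and `c²` writes the sum in three ways; adding them leaves only the
  -- cyclic sum of `Ξ`.
  have key : ∀ Ξ : F → F → F → E,
      3 * ∑ τ : Perm (Fin (2 * k + 1)), ((Perm.sign τ : ℤ) : ℝ) *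
        f (Function.update (pairs Ω (Fin.tail (v ∘ τ))) j
          (Ξ ((v ∘ τ) 0) ((v ∘ τ) b) ((v ∘ τ) d))) =
      ∑ τ : Perm (Fin (2 * k + 1)), ((Perm.sign τ : ℤ) : ℝ) *
        f (Function.update (pairs Ω (Fin.tail (v ∘ τ))) j
          (Ξ ((v ∘ τ) 0) ((v ∘ τ) b) ((v ∘ τ) d) + Ξ ((v ∘ τ) b) ((v ∘ τ) d) ((v ∘ τ) 0) +
            Ξ ((v ∘ τ) d) ((v ∘ τ) 0) ((v ∘ τ) b))) := by
    intro Ξ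
    let T : (Fin (2 * k + 1) → F) → ℝ := fun z =>
      f (Function.update (pairs Ω (Fin.tail z)) j (Ξ (z 0) (z b) (z d)))
    have e1 := sum_perm_comp v T c hc
    have e2 := sum_perm_comp v (fun z => T (z ∘ c)) c hc
    have e3 : ∀ z, T (z ∘ c) = f (Function.update (pairs Ω (Fin.tail z)) j
        (Ξ (z b) (z d) (z 0))) := by
      intro z
      simp only [T, hupd, Function.comp_apply, hc0, hcb, hcd]
    have e4 : ∀ z, T ((z ∘ c) ∘ c) = f (Function.update (pairs Ω (Fin.tail z)) j
        (Ξ (z d) (z 0) (z b))) := by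
      intro z
      rw [e3, hupd]
      simp only [Function.comp_apply, hc0, hcb, hcd]
    simp only [f.map_update_add, mul_add, Finset.sum_add_distrib]
    simp only [← e3, ← e4]
    rw [e2, e1]
    simp only [T]
    ring
  have h1 := key Θ
  have h2 := key Θ'
  have h3 : ∀ u v w, Θ u v w + Θ v w u + Θ w u v = Θ' u v w + Θ' v w u + Θ' w u v :=
    fun u v w => h v w u
  simp only [h3] at h1
  rw [← h2] at h1
  exact mul_left_cancel₀ three_ne_zero h1

variable [FiniteDimensional ℝ E] [LieGroup 𝓘(ℝ, E) ∞ G] [FiniteDimensional ℝ F]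

/-- The Chern-Weil forms are closed. -/
theorem extDeriv_cwForm_curv {k : ℕ} (f : InvariantPolynomial E G k) {α : F → F →L[ℝ] E}
    (hα : ContDiff ℝ ∞ α) (x : F) : extDeriv (fun y => cwForm f (curv G α y)) x = 0 := by
  have hΩ := contDiff_curv (G := G) hα
  have hΩd : DifferentiableAt ℝ (curv G α) x := hΩ.contDiffAt.differentiableAt (by simp)
  have hd := ((contDiff_cwForm f hΩ).contDiffAt (x := x)).differentiableAt (by simp)
  ext v
  rw [extDeriv_apply hd]
  -- By the Leibniz rule this is the derivative, in direction `z 0`, of `f(Ω, …, Ω)` on the other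
  -- vectors before alternation.
  let T : (Fin (2 * k + 1) → F) → ℝ := fun z => ∑ j, f.toFun (Function.update
    (pairs (fun a b => curv G α x a b) (Fin.tail z)) j
    (fderiv ℝ (curv G α) x (z 0) (Fin.tail z ⟨2 * j, by omega⟩)
      (Fin.tail z ⟨2 * j + 1, by omega⟩)))
  have h1 : ∀ (u : F) (w : Fin (2 * k) → F),
      fderiv ℝ (fun y => cwForm f (curv G α y) w) x u = (1 / 2 ^ k : ℝ) *
        ∑ σ : Perm (Fin (2 * k)), ((Perm.sign σ : ℤ) : ℝ) *
          T (Fin.cons u (fun j => w (σ j))) := by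
    intro u w
    have e1 : ∀ a b, HasFDerivAt (fun y => curv G α y a b) _ x := fun a b =>
      (hΩd.hasFDerivAt.clm_apply (hasFDerivAt_const a x)).clm_apply (hasFDerivAt_const b x)
    have e2 := HasFDerivAt.const_mul (HasFDerivAt.fun_sum (u := Finset.univ)
      fun (σ : Perm (Fin (2 * k))) _ => HasFDerivAt.const_mul
      (HasFDerivAt.multilinear_comp f.toContinuous fun i : Fin k =>
        e1 (w (σ ⟨2 * i, by omega⟩)) (w (σ ⟨2 * i + 1, by omega⟩))) ((Perm.sign σ : ℤ) : ℝ))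
      (1 / 2 ^ k : ℝ)
    have e3 : (fun y => cwForm f (curv G α y) w) = _ := funext fun y => cwForm_apply f _ w
    rw [e3]
    refine (DFunLike.congr_fun e2.fderiv u).trans ?_
    simp [T, Fin.tail]
    rfl
  simp only [h1]
  have h2 : ∑ i : Fin (2 * k + 1), (-1 : ℤ) ^ (i : ℕ) • ((1 / 2 ^ k : ℝ) *
      ∑ σ : Perm (Fin (2 * k)), ((Perm.sign σ : ℤ) : ℝ) *
        T (Fin.cons (v i) (fun j => i.removeNth v (σ j)))) =
      (1 / 2 ^ k : ℝ) * ∑ τ : Perm (Fin (2 * k + 1)), ((Perm.sign τ : ℤ) : ℝ) * T (v ∘ τ) := by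
    rw [← sum_perm_fin_succ, Finset.mul_sum]
    refine Finset.sum_congr rfl fun i _ => ?_
    simp only [zsmul_eq_mul]
    push_cast
    ring
  refine h2.trans ?_
  have h3 : ∑ τ : Perm (Fin (2 * k + 1)), ((Perm.sign τ : ℤ) : ℝ) * T (v ∘ τ) = 0 := by
    simp only [T, Finset.mul_sum]
    rw [Finset.sum_comm]
    -- Bianchi controls only cyclic sums, but these are all that the alternation sees. The
    -- replacement is a bracket with a fixed vector for each `τ`, so the sum over `j` vanishes by
    -- `sum_lieB`.
    have h4 := fun j => sum_perm_update_congr f.toFun (fun a b => curv G α x a b)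
      (fun a b c => fderiv ℝ (curv G α) x a b c)
      (fun a b c => -lieB E G (α x a) (curv G α x b c))
      (fun u v w => by
        rw [fderiv_curv_cyclic hα]
        abel) v j
    rw [Finset.sum_congr rfl fun j _ => h4 j, Finset.sum_comm]
    refine Finset.sum_eq_zero fun τ _ => ?_
    rw [← Finset.mul_sum]
    simp only [f.toFun.map_update_neg, Finset.sum_neg_distrib]
    have h5 := f.sum_lieB (α x ((v ∘ τ) 0))
      (pairs (fun a b => curv G α x a b) (Fin.tail (v ∘ τ)))
    refine mul_eq_zero_of_right _ (neg_eq_zero.2 ?_)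
    exact h5
  rw [h3, mul_zero]
  rfl

end ChernWeilClosed

/-! ### Locality and gluing of forms on diffeological spaces -/

section Diffeological

theorem contDiff_bump_id {n : ℕ} {x : Euc n} {φ : Euc n → Euc n} (h : φ =ᶠ[𝓝 x] id) :
    φ x = x ∧ fderiv ℝ φ x = ContinuousLinearMap.id ℝ (Euc n) := by
  refine ⟨h.eq_of_nhds, ?_⟩
  rw [h.fderiv_eq, fderiv_id]

variable {X : Type*} [DiffeologicalSpace X] {V : Type*} [NormedAddCommGroup V] [NormedSpace ℝ V]

theorem DForm.onPlot_of_eq {k n : ℕ} (β : DForm X V k) {p p' : Euc n → X} (hp : IsPlot p)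
    (hp' : IsPlot p') (h : p = p') : β.onPlot p hp = β.onPlot p' hp' := by
  subst h
  rfl

/-- The values of a form along a plot depend on the germ of the plot only. -/
theorem DForm.onPlot_congr {k n : ℕ} (β : DForm X V k) {p p' : Euc n → X} (hp : IsPlot p)
    (hp' : IsPlot p') {x : Euc n} (h : p =ᶠ[𝓝 x] p') : β.onPlot p hp x = β.onPlot p' hp' x := by
  obtain ⟨φ, hφ, hm, hid⟩ := exists_contDiff_mapsTo_eventuallyEq_id h
  obtain ⟨h1, h2⟩ := contDiff_bump_id hid
  have e1 := β.pullback p hp φ hφ x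
  have e2 := β.pullback p' hp' φ hφ x
  rw [h1, h2] at e1 e2
  have e3 : p ∘ φ = p' ∘ φ := funext fun y => hm y
  have e4 := congrFun (β.onPlot_of_eq (isPlot_reparam hp hφ) (isPlot_reparam hp' hφ) e3) x
  rw [e1, e2] at e4
  exact e4

/-- A form can be given by smooth local representatives on sufficiently many plots. -/
theorem exists_dForm {k : ℕ}
    (Rep : ∀ n : ℕ, (Euc n → X) → (Euc n → (Euc n) [⋀^Fin k]→L[ℝ] V) → Prop)
    (smooth : ∀ n p w, Rep n p w → ContDiff ℝ ∞ w)
    (pullback : ∀ m n p w (φ : Euc m → Euc n), ContDiff ℝ ∞ φ → Rep n p w →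
      Rep m (p ∘ φ) (fun x => (w (φ x)).compContinuousLinearMap (fderiv ℝ φ x)))
    (congr : ∀ n p w p' w' x, Rep n p w → Rep n p' w' → p =ᶠ[𝓝 x] p' → w x = w' x)
    (exists_rep : ∀ n (p : Euc n → X), IsPlot p → ∀ x, ∃ p' w', Rep n p' w' ∧ p =ᶠ[𝓝 x] p') :
    ∃ β : DForm X V k, ∀ n p w (hp : IsPlot p), Rep n p w → β.onPlot p hp = w := by
  -- A representative is chosen around every point and evaluated only at that point; `hval` shows
  -- that the choice does not matter.
  choose! p' w' hrep heq using exists_rep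
  have hval : ∀ n p (hp : IsPlot p) x q w, Rep n q w → p =ᶠ[𝓝 x] q → w' n p x x = w x :=
    fun n p hp x q w hq hpq =>
      congr n _ _ _ _ x (hrep n p hp x) hq ((heq n p hp x).symm.trans hpq)
  refine ⟨⟨fun {n} p _ x => w' n p x x, ?_, ?_⟩, fun n p w hp hw => funext fun x => ?_⟩
  · intro n p hp
    rw [contDiff_iff_contDiffAt]
    intro x
    have h : (fun y => w' n p y y) =ᶠ[𝓝 x] w' n p x := by
      filter_upwards [(heq n p hp x).eventually_nhds] with y hy
      exact hval n p hp y _ _ (hrep n p hp x) hy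
    exact (smooth _ _ _ (hrep n p hp x)).contDiffAt.congr_of_eventuallyEq h
  · intro m n p hp φ hφ x
    have h1 := pullback m n _ _ φ hφ (hrep n p hp (φ x))
    have h2 : p ∘ φ =ᶠ[𝓝 x] p' n p (φ x) ∘ φ :=
      (hφ.continuous.tendsto x).eventually (heq n p hp (φ x))
    exact hval m _ (isPlot_reparam hp hφ) x _ _ h1 h2
  · exact hval n p hp x p w hw Filter.EventuallyEq.rfl

/-- The plots of a generated diffeology are locally given by the generating ones, if these are
stable under changes of parameters and contain the constant maps. -/
theorem exists_eventuallyEq_of_isPlot_generateFrom {Y : Type*} {S : Set (Σ n : ℕ, Euc n → Y)}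
    (hconst : ∀ n x, (⟨n, fun _ => x⟩ : Σ n : ℕ, Euc n → Y) ∈ S)
    (hre : ∀ m n (p : Euc n → Y) (φ : Euc m → Euc n), ContDiff ℝ ∞ φ →
      (⟨n, p⟩ : Σ n : ℕ, Euc n → Y) ∈ S → (⟨m, p ∘ φ⟩ : Σ n : ℕ, Euc n → Y) ∈ S)
    {n : ℕ} {p : Euc n → Y} (hp : @IsPlot Y (DiffeologicalSpace.generateFrom S) n p) (x : Euc n) :
    ∃ p' : Euc n → Y, (⟨n, p'⟩ : Σ n : ℕ, Euc n → Y) ∈ S ∧ p =ᶠ[𝓝 x] p' := by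
  -- The maps locally given by members of `S` already form a diffeology containing `S`, hence they
  -- include all plots of the generated one.
  let d : DiffeologicalSpace Y :=
    { plots := fun n => {p | ∀ x, ∃ p' : Euc n → Y,
        (⟨n, p'⟩ : Σ n : ℕ, Euc n → Y) ∈ S ∧ p =ᶠ[𝓝 x] p'}
      constant_plots := fun x _ => ⟨_, hconst _ x, Filter.EventuallyEq.rfl⟩
      plot_reparam := fun {m n p φ} hp hφ x => by
        obtain ⟨p', hp', h⟩ := hp (φ x)
        exact ⟨p' ∘ φ, hre _ _ _ _ hφ hp', (hφ.continuous.tendsto x).eventually h⟩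
      locality := fun {n p} hp x => by
        obtain ⟨u, hu, hxu, h⟩ := hp x
        obtain ⟨φ, hφ, hm, hid⟩ := exists_contDiff_mapsTo_eventuallyEq_id (hu.mem_nhds hxu)
        obtain ⟨p', hp', h'⟩ := h hm hφ x
        refine ⟨p', hp', Filter.EventuallyEq.trans ?_ h'⟩
        filter_upwards [hid] with y hy
        simp [hy] }
  have hle : DiffeologicalSpace.generateFrom S ≤ d :=
    DiffeologicalSpace.generateFrom_le_iff.2 fun n p hp x => ⟨p, hp, Filter.EventuallyEq.rfl⟩
  exact DiffeologicalSpace.le_iff'.1 hle n p hp x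

end Diffeological

/-! ### Local lifts of maps to the circle -/

section Circle

theorem exists_lift_circle {n : ℕ} {c : Euc n → S1} (hc : IsPlot c) (x : Euc n) :
    ∃ θ : Euc n → ℝ, ContDiff ℝ ∞ θ ∧ c =ᶠ[𝓝 x] fun y => (θ y : S1) := by
  obtain ⟨c', ⟨θ, hθ, h⟩, h'⟩ := exists_eventuallyEq_of_isPlot_generateFrom (Y := S1)
    (S := {q | ∃ θ : Euc q.1 → ℝ, ContDiff ℝ ∞ θ ∧ q.2 = fun x => (θ x : S1)})
    (fun n x => by
      obtain ⟨t, rfl⟩ := QuotientAddGroup.mk_surjective x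
      exact ⟨fun _ => t, contDiff_const, rfl⟩)
    (fun m n p φ hφ ⟨θ, hθ, h⟩ => ⟨θ ∘ φ, hθ.comp hφ, by
      dsimp only at h ⊢
      rw [h]
      rfl⟩) hc x
  dsimp only at h
  exact ⟨θ, hθ, h ▸ h'⟩

/-- Two continuous lifts of a map to the circle differ locally by a constant. -/
theorem exists_eventuallyEq_add_of_coe_eq {Y : Type*} [TopologicalSpace Y] {θ θ' : Y → ℝ} {x : Y}
    (hθ : ContinuousAt θ x) (hθ' : ContinuousAt θ' x)
    (h : ∀ᶠ y in 𝓝 x, (θ y : S1) = (θ' y : S1)) :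
    ∃ c : ℝ, (c : S1) = 0 ∧ ∀ᶠ y in 𝓝 x, θ' y = θ y + c := by
  refine ⟨θ' x - θ x, ?_, ?_⟩
  · rw [AddCircle.coe_sub, h.self_of_nhds, sub_self]
  · have hc : ContinuousAt (fun y => (θ' y - θ y) - (θ' x - θ x)) x :=
      (hθ'.sub hθ).sub continuousAt_const
    -- This quantity is an integer multiple of `2π`, so a bound below `2π` forces it to be zero.
    have hlt : ∀ᶠ y in 𝓝 x, |(θ' y - θ y) - (θ' x - θ x)| < 2 * Real.pi := by
      have h0 : |(θ' x - θ x) - (θ' x - θ x)| < 2 * Real.pi := by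
        rw [sub_self, abs_zero]
        exact Real.two_pi_pos
      exact hc.abs.eventually_lt continuousAt_const h0
    filter_upwards [hlt, h] with y hy hy'
    have h0 : (((θ' y - θ y) - (θ' x - θ x) : ℝ) : S1) = 0 := by
      rw [AddCircle.coe_sub, AddCircle.coe_sub, AddCircle.coe_sub, hy', h.self_of_nhds]
      simp
    obtain ⟨m, hm⟩ := AddCircle.coe_eq_zero_iff (2 * Real.pi) |>.1 h0
    rw [← hm, zsmul_eq_mul, abs_mul, abs_of_pos Real.two_pi_pos] at hy
    have hm1 : |(m : ℝ)| < 1 := by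
      by_contra hcon
      have := mul_le_mul_of_nonneg_right (not_lt.1 hcon) Real.two_pi_pos.le
      linarith
    have hm0 : m = 0 := by
      have : |m| < 1 := by exact_mod_cast hm1
      exact Int.abs_lt_one_iff.1 this
    rw [hm0, zero_smul] at hm
    linarith

end Circle

variable {E : Type*} [NormedAddCommGroup E] [NormedSpace ℝ E]
  {G : Type*} [TopologicalSpace G] [ChartedSpace E G] [Group G] [LieGroup 𝓘(ℝ, E) ∞ G]
  {P : Type*} [DiffeologicalSpace P] {M : Type*} [DiffeologicalSpace M]

/-! ### Smooth families of loops -/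

section SmoothLoops

theorem SmoothLoops.comp {m n : ℕ} {γ : Euc n → LoopGroup E G} (hγ : SmoothLoops γ)
    {φ : Euc m → Euc n} (hφ : ContDiff ℝ ∞ φ) : SmoothLoops (fun x => γ (φ x)) :=
  ContMDiff.comp (g := fun y : Euc n × ℝ => (γ y.1 : S1 → G) (y.2 : S1))
    (f := fun y : Euc m × ℝ => (φ y.1, y.2)) hγ
    ((hφ.comp contDiff_fst).prodMk contDiff_snd).contMDiff

theorem SmoothLoops.mul {n : ℕ} {γ δ : Euc n → LoopGroup E G} (hγ : SmoothLoops γ)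
    (hδ : SmoothLoops δ) : SmoothLoops (fun x => γ x * δ x) :=
  ContMDiff.mul hγ hδ

theorem SmoothLoops.inv {n : ℕ} {γ : Euc n → LoopGroup E G} (hγ : SmoothLoops γ) :
    SmoothLoops (fun x => (γ x)⁻¹) :=
  ContMDiff.inv hγ

theorem SmoothLoops.contMDiff_eval {n : ℕ} {γ : Euc n → LoopGroup E G} (hγ : SmoothLoops γ)
    {θ : Euc n → ℝ} (hθ : ContDiff ℝ ∞ θ) :
    ContMDiff 𝓘(ℝ, Euc n) 𝓘(ℝ, E) ∞ (fun x => (γ x : S1 → G) (θ x : S1)) :=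
  ContMDiff.comp (g := fun y : Euc n × ℝ => (γ y.1 : S1 → G) (y.2 : S1))
    (f := fun y : Euc n => (y, θ y)) hγ (contDiff_id.prodMk hθ).contMDiff

/-- Chain rule along the graph of `θ`. The first term matches the inhomogeneous part of the
connection, the second that of the Higgs field. -/
theorem SmoothLoops.leftLog_eval {n : ℕ} {γ : Euc n → LoopGroup E G} (hγ : SmoothLoops γ)
    {θ : Euc n → ℝ} (hθ : ContDiff ℝ ∞ θ) (x v : Euc n) :
    leftLog E (fun y => (γ y : S1 → G) (θ y : S1)) x v =
      leftLog E (fun y => (γ y : S1 → G) (θ x : S1)) x v +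
        fderiv ℝ θ x v • leftLog E (fun t : ℝ => (γ x : S1 → G) (t : S1)) (θ x) 1 := by
  have hd : DifferentiableAt ℝ θ x := hθ.contDiffAt.differentiableAt (by simp)
  have h := leftLog_comp (g := fun y : Euc n × ℝ => (γ y.1 : S1 → G) (y.2 : S1))
    (φ := fun y : Euc n => (y, θ y)) (x := x) (ContMDiff.contMDiffAt hγ)
    (contDiff_id.prodMk hθ).contDiffAt
  have h2 : fderiv ℝ (fun y : Euc n => (y, θ y)) x = (ContinuousLinearMap.id ℝ _).prod
      (fderiv ℝ θ x) := ((hasFDerivAt_id x).prodMk hd.hasFDerivAt).fderiv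
  rw [h2] at h
  refine (DFunLike.congr_fun h v).trans ?_
  simp only [ContinuousLinearMap.comp_apply, ContinuousLinearMap.prod_apply,
    ContinuousLinearMap.id_apply]
  rw [leftLog_prod (ContMDiff.contMDiffAt hγ), ← map_smul, smul_eq_mul, mul_one]

end SmoothLoops

namespace LoopBundle

/-! ### Local lifts of plots, and comparison of lifts in the bundle -/

section Plots

variable (B : LoopBundle E G P M)

theorem exists_lift_total {n : ℕ} {q : Euc n → B.Total} (hq : IsPlot q) (x : Euc n) :
    ∃ (a : Euc n → P) (g : Euc n → G) (θ : Euc n → ℝ),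
      IsPlot a ∧ ContMDiff 𝓘(ℝ, Euc n) 𝓘(ℝ, E) ∞ g ∧ ContDiff ℝ ∞ θ ∧
        q =ᶠ[𝓝 x] fun y => B.cmk (a y) (g y) (θ y : S1) := by
  obtain ⟨q', ⟨a, g, θ, ha, hg, hθ, h⟩, h'⟩ := exists_eventuallyEq_of_isPlot_generateFrom
    (S := {q : Σ n : ℕ, Euc n → B.Total |
      ∃ (a : Euc q.1 → P) (g : Euc q.1 → G) (θ : Euc q.1 → ℝ),
      IsPlot a ∧ ContMDiff 𝓘(ℝ, Euc q.1) 𝓘(ℝ, E) ∞ g ∧ ContDiff ℝ ∞ θ ∧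
      q.2 = fun x => B.cmk (a x) (g x) (θ x : S1)})
    (fun n x => by
      obtain ⟨⟨p, g, t⟩, rfl⟩ := Quotient.mk_surjective x
      obtain ⟨t, rfl⟩ := QuotientAddGroup.mk_surjective t
      exact ⟨fun _ => p, fun _ => g, fun _ => t, isPlot_const, contMDiff_const, contDiff_const,
        rfl⟩)
    (fun m n p φ hφ ⟨a, g, θ, ha, hg, hθ, h⟩ => ⟨a ∘ φ, g ∘ φ, θ ∘ φ, isPlot_reparam ha hφ,
      hg.comp hφ.contMDiff, hθ.comp hφ, by
        dsimp only at h ⊢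
        rw [h]
        rfl⟩) hq x
  dsimp only at h
  exact ⟨a, g, θ, ha, hg, hθ, h ▸ h'⟩

theorem exists_lift_base {n : ℕ} {b : Euc n → M} (hb : IsPlot b) (x : Euc n) :
    ∃ a : Euc n → P, IsPlot a ∧ b =ᶠ[𝓝 x] fun y => B.proj (a y) := by
  obtain ⟨U, hU, hxU, s, hs, hs', -⟩ := B.locally_trivial (b x)
  have hbU : b ⁻¹' U ∈ 𝓝 x := (isOpen_iff_preimages_plots.1 hU n b hb).mem_nhds hxU
  obtain ⟨φ, hφ, hm, hid⟩ := exists_contDiff_mapsTo_eventuallyEq_id hbU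
  refine ⟨_, hs' n (b ∘ φ) (isPlot_reparam hb hφ) hm, ?_⟩
  filter_upwards [hid] with y hy
  have h := hs _ (hm y)
  rw [hy] at h
  rw [Function.comp_apply, hy]
  exact h.symm

theorem exists_lift_cproj {n : ℕ} {c : Euc n → M × S1} (hc : IsPlot c) (x : Euc n) :
    ∃ q : Euc n → B.Total, IsPlot q ∧ c =ᶠ[𝓝 x] B.cproj ∘ q := by
  obtain ⟨a, ha, h1⟩ := B.exists_lift_base hc.1 x
  obtain ⟨θ, hθ, h2⟩ := exists_lift_circle hc.2 x
  refine ⟨_, B.isPlot_cmk ha contMDiff_const (g := fun _ => (1 : G)) hθ, ?_⟩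
  filter_upwards [h1, h2] with y h1 h2
  exact Prod.ext h1 h2

variable {B} in
theorem act_injective {p : P} {γ δ : LoopGroup E G} (h : B.act p γ = B.act p δ) : γ = δ := by
  have h1 : B.act p (γ * δ⁻¹) = p := by
    rw [B.act_mul, h, ← B.act_mul, mul_inv_cancel, B.act_one]
  exact mul_inv_eq_one.1 (B.free _ _ h1)

/-- Two smooth families of points of `P` in the same fibres differ by a smooth family of loops. -/
theorem exists_smoothLoops {n : ℕ} {a a' : Euc n → P} (ha : IsPlot a) (ha' : IsPlot a')
    {x : Euc n} (h : ∀ᶠ y in 𝓝 x, B.proj (a y) = B.proj (a' y)) :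
    ∃ γ : Euc n → LoopGroup E G, SmoothLoops γ ∧ a' =ᶠ[𝓝 x] fun y => B.act (a y) (γ y) := by
  obtain ⟨U, hU, hxU, s, -, -, hs⟩ := B.locally_trivial (B.proj (a x))
  have hbU : (B.proj ∘ a) ⁻¹' U ∈ 𝓝 x :=
    (isOpen_iff_preimages_plots.1 hU n _ (B.proj_smooth n a ha)).mem_nhds hxU
  obtain ⟨φ, hφ, hm, hid⟩ := exists_contDiff_mapsTo_eventuallyEq_id (Filter.inter_mem hbU h)
  obtain ⟨γ, hγ, h1⟩ := hs n (a ∘ φ) (isPlot_reparam ha hφ) fun y => (hm y).1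
  obtain ⟨δ, hδ, h2⟩ := hs n (a' ∘ φ) (isPlot_reparam ha' hφ) fun y => by
    have := (hm y).2
    rw [Set.mem_ofPred_eq] at this
    rw [Function.comp_apply, ← this]
    exact (hm y).1
  -- Locally `a = sγ` and `a' = sδ` for the same section `s`.
  refine ⟨fun y => (γ y)⁻¹ * δ y, hγ.inv.mul hδ, ?_⟩
  filter_upwards [hid] with y hy
  have e : a' y = (a' ∘ φ) y := by rw [Function.comp_apply, hy]; rfl
  have e' : a y = (a ∘ φ) y := by rw [Function.comp_apply, hy]; rfl
  have e2 : B.proj ((a' ∘ φ) y) = B.proj ((a ∘ φ) y) := (hm y).2.symm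
  rw [e', e, h2 y, h1 y, e2, ← B.act_mul, mul_inv_cancel_left]

end Plots

/-! ### Transformation of a connection under families of loops -/

namespace Connection

variable {B : LoopBundle E G P M} (A : B.Connection)

theorem form_of_eq {n : ℕ} {a a' : Euc n → P} (ha : IsPlot a) (ha' : IsPlot a') (h : a = a') :
    A.form a ha = A.form a' ha' := by
  subst h
  rfl

theorem form_congr {n : ℕ} {a a' : Euc n → P} (ha : IsPlot a) (ha' : IsPlot a') {x : Euc n}
    (h : a =ᶠ[𝓝 x] a') (θ : S1) : A.form a ha θ x = A.form a' ha' θ x := by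
  obtain ⟨φ, hφ, hm, hid⟩ := exists_contDiff_mapsTo_eventuallyEq_id h
  obtain ⟨h1, h2⟩ := contDiff_bump_id hid
  have e1 := A.pullback a ha φ hφ θ x
  have e2 := A.pullback a' ha' φ hφ θ x
  rw [h1, h2, ContinuousLinearMap.comp_id] at e1 e2
  rw [← e1, ← e2]
  exact congrFun (congrFun (A.form_of_eq _ _ (funext fun y => hm y)) θ) x

/-- Behaviour of a connection under smooth families of loops. -/
theorem form_act {n : ℕ} {a : Euc n → P} (ha : IsPlot a) {γ : Euc n → LoopGroup E G}
    (hγ : SmoothLoops γ) (θ : S1) (x : Euc n) :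
    A.form (fun y => B.act (a y) (γ y)) (B.act_smooth a γ ha hγ) θ x =
      (Ad E ((γ x : S1 → G) θ)⁻¹).comp (A.form a ha θ x) +
        leftLog E (fun y => (γ y : S1 → G) θ) x := by
  have hfr : Module.finrank ℝ (Euc n × Euc n) = Module.finrank ℝ (Euc (n + n)) := by
    simp
  -- The family `a(y)γ(z)` must be parametrised by some `Euc m` to be a plot; any linear
  -- identification will do. On the diagonal the form is the sum of its restrictions to the two
  -- slices, given by `equivariant` and `vertical`.
  let L : (Euc n × Euc n) ≃L[ℝ] Euc (n + n) := ContinuousLinearEquiv.ofFinrankEq hfr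
  let b : Euc (n + n) → P := fun z => B.act (a (L.symm z).1) (γ (L.symm z).2)
  have hb : IsPlot b := B.act_smooth (fun z => a (L.symm z).1) (fun z => γ (L.symm z).2)
    (isPlot_reparam ha (f := fun z => (L.symm z).1) (contDiff_fst.comp L.symm.contDiff))
    (hγ.comp (contDiff_snd.comp L.symm.contDiff))
  have hL : ∀ {f : Euc n → Euc n × Euc n} {f' : Euc n →L[ℝ] Euc n × Euc n},
      HasFDerivAt f f' x → fderiv ℝ (fun y => L (f y)) x = (L : _ →L[ℝ] _).comp f' :=
    fun hf => (L.hasFDerivAt.comp x hf).fderiv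
  have e1 := A.pullback b hb (fun y => L (y, x))
    (L.contDiff.comp (contDiff_id.prodMk contDiff_const)) θ x
  have e2 := A.pullback b hb (fun y => L (x, y))
    (L.contDiff.comp (contDiff_const.prodMk contDiff_id)) θ x
  have e3 := A.pullback b hb (fun y => L (y, y))
    (L.contDiff.comp (contDiff_id.prodMk contDiff_id)) θ x
  rw [hL (hasFDerivAt_prodMk_left x x)] at e1
  rw [hL (hasFDerivAt_prodMk_right x x)] at e2
  rw [hL (f := fun y => (y, y)) ((hasFDerivAt_id x).prodMk (hasFDerivAt_id x))] at e3
  have c1 : b ∘ (fun y => L (y, x)) = fun y => B.act (a y) (γ x) := by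
    ext y
    simp [b]
  have c2 : b ∘ (fun y => L (x, y)) = fun y => B.act (a x) (γ y) := by
    ext y
    simp [b]
  have c3 : b ∘ (fun y => L (y, y)) = fun y => B.act (a y) (γ y) := by
    ext y
    simp [b]
  rw [A.form_of_eq _ (B.act_smooth a _ ha (smoothLoops_const (γ x))) c1, A.equivariant a ha] at e1
  rw [A.form_of_eq _ (B.act_smooth _ γ isPlot_const hγ) c2, A.vertical _ γ hγ] at e2
  rw [A.form_of_eq _ (B.act_smooth a γ ha hγ) c3] at e3
  rw [e1, e2, e3]
  ext v
  simp [← map_add]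

end Connection

end LoopBundle

end

end Caloron

namespace Caloron

noncomputable section

variable {E : Type*} [NormedAddCommGroup E] [NormedSpace ℝ E]
  {G : Type*} [TopologicalSpace G] [ChartedSpace E G] [Group G] [LieGroup 𝓘(ℝ, E) ∞ G]
  {P : Type*} [DiffeologicalSpace P] {M : Type*} [DiffeologicalSpace M]

/-! ### The caloron form on lifts and its gauge behaviour -/

namespace LoopBundle

variable {B : LoopBundle E G P M} (A : B.Connection) (Φ : B.HiggsField)

/-- The form `Ad(g⁻¹)A(θ) + Θ + Ad(g⁻¹)Φ dθ` along a smooth family of points of `P × G × S¹`. -/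
def calForm {n : ℕ} (a : Euc n → P) (ha : IsPlot a) (g : Euc n → G) (θ : Euc n → ℝ) (x : Euc n) :
    Euc n →L[ℝ] E :=
  (Ad E (g x)⁻¹).comp (A.form a ha (θ x : S1) x) + leftLog E g x +
    (fderiv ℝ θ x).smulRight (Ad E (g x)⁻¹ (Φ.toFun (a x) (θ x : S1)))

theorem calForm_apply {n : ℕ} (a : Euc n → P) (ha : IsPlot a) (g : Euc n → G) (θ : Euc n → ℝ)
    (x v : Euc n) : calForm A Φ a ha g θ x v =
      Ad E (g x)⁻¹ (A.form a ha (θ x : S1) x v) + leftLog E g x v +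
        fderiv ℝ θ x v • Ad E (g x)⁻¹ (Φ.toFun (a x) (θ x : S1)) := rfl

theorem calForm_pullback {m n : ℕ} {a : Euc n → P} (ha : IsPlot a) {g : Euc n → G}
    (hg : ContMDiff 𝓘(ℝ, Euc n) 𝓘(ℝ, E) ∞ g) {θ : Euc n → ℝ} (hθ : ContDiff ℝ ∞ θ)
    {φ : Euc m → Euc n} (hφ : ContDiff ℝ ∞ φ) (x : Euc m) :
    calForm A Φ (a ∘ φ) (isPlot_reparam ha hφ) (g ∘ φ) (θ ∘ φ) x =
      (calForm A Φ a ha g θ (φ x)).comp (fderiv ℝ φ x) := by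
  have h1 : leftLog E (g ∘ φ) x = _ :=
    leftLog_comp (g := g) (φ := φ) hg.contMDiffAt hφ.contDiffAt
  have h2 : fderiv ℝ (θ ∘ φ) x = _ := fderiv_comp x (hθ.contDiffAt.differentiableAt (by simp))
    (hφ.contDiffAt.differentiableAt (by simp))
  ext v
  rw [calForm_apply, h1, h2, A.pullback a ha φ hφ]
  rfl

/-- Only the class of `θ` modulo `2π` matters: two lifts differ locally by a constant and have the
same `dθ`. -/
theorem calForm_congr {n : ℕ} {a a' : Euc n → P} (ha : IsPlot a) (ha' : IsPlot a')
    {g g' : Euc n → G} {θ θ' : Euc n → ℝ} {x : Euc n} (haa : a =ᶠ[𝓝 x] a') (hgg : g =ᶠ[𝓝 x] g')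
    (hθ : ContinuousAt θ x) (hθ' : ContinuousAt θ' x)
    (hθθ : ∀ᶠ y in 𝓝 x, (θ y : S1) = (θ' y : S1)) :
    calForm A Φ a ha g θ x = calForm A Φ a' ha' g' θ' x := by
  obtain ⟨c, -, hc⟩ := exists_eventuallyEq_add_of_coe_eq hθ hθ' hθθ
  have h1 : fderiv ℝ θ' x = fderiv ℝ θ x := by
    rw [Filter.EventuallyEq.fderiv_eq (f := fun y => θ y + c) hc, fderiv_add_const]
  unfold calForm
  rw [A.form_congr ha ha' haa, leftLog_congr hgg, h1, haa.eq_of_nhds, hgg.eq_of_nhds,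
    hθθ.self_of_nhds]

theorem calForm_mul {n : ℕ} {a : Euc n → P} (ha : IsPlot a) {g h : Euc n → G}
    [FiniteDimensional ℝ E]
    (hg : ContMDiff 𝓘(ℝ, Euc n) 𝓘(ℝ, E) ∞ g) (hh : ContMDiff 𝓘(ℝ, Euc n) 𝓘(ℝ, E) ∞ h)
    (θ : Euc n → ℝ) (x : Euc n) :
    calForm A Φ a ha (fun y => g y * h y) θ x =
      (Ad E (h x)⁻¹).comp (calForm A Φ a ha g θ x) + leftLog E h x := by
  ext v
  simp only [calForm_apply, ContinuousLinearMap.comp_apply, add_apply,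
    leftLog_mul hg.contMDiffAt hh.contMDiffAt, mul_inv_rev, Ad_mul_apply, map_add, map_smul]
  abel

variable [FiniteDimensional ℝ E]

theorem contDiff_calForm {n : ℕ} {a : Euc n → P} (ha : IsPlot a) {g : Euc n → G}
    (hg : ContMDiff 𝓘(ℝ, Euc n) 𝓘(ℝ, E) ∞ g) {θ : Euc n → ℝ} (hθ : ContDiff ℝ ∞ θ) :
    ContDiff ℝ ∞ (calForm A Φ a ha g θ) := by
  have h1 := contDiff_Ad hg.inv
  have h2 := contDiff_leftLog hg
  have h3 : ContDiff ℝ ∞ (fun x => A.form a ha (θ x : S1) x) :=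
    (A.smooth a ha).comp (contDiff_id.prodMk hθ)
  have h4 : ContDiff ℝ ∞ (fun x => Φ.toFun (a x) (θ x : S1)) :=
    (Φ.smooth a ha).comp (contDiff_id.prodMk hθ)
  have h5 : ContDiff ℝ ∞ (fderiv ℝ θ) := hθ.fderiv_right (by simp)
  exact ((h1.clm_comp h3).add h2).add (h5.smulRight (h1.clm_apply h4))

/-- The inhomogeneous terms of `A` and `Φ` add up to the logarithmic derivative of `y ↦ γ(y)(θ(y))`,
and the factor `γ(θ)⁻¹` contributes its negative, all conjugated alike. This is where the
equivariance of the Higgs field is needed. -/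
theorem calForm_act {n : ℕ} {a : Euc n → P} (ha : IsPlot a) {g : Euc n → G}
    (hg : ContMDiff 𝓘(ℝ, Euc n) 𝓘(ℝ, E) ∞ g) {θ : Euc n → ℝ} (hθ : ContDiff ℝ ∞ θ)
    {γ : Euc n → LoopGroup E G} (hγ : SmoothLoops γ) (x : Euc n) :
    calForm A Φ (fun y => B.act (a y) (γ y)) (B.act_smooth a γ ha hγ)
        (fun y => ((γ y : S1 → G) (θ y : S1))⁻¹ * g y) θ x =
      calForm A Φ a ha g θ x := by
  have hγθ := hγ.contMDiff_eval hθ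
  ext v
  simp only [calForm_apply, A.form_act ha hγ, Φ.equivariant,
    leftLog_mul hγθ.inv.contMDiffAt hg.contMDiffAt, leftLog_inv hγθ.contMDiffAt,
    ContinuousLinearMap.comp_apply, add_apply, neg_apply, hγ.leftLog_eval hθ,
    mul_inv_rev, inv_inv, Ad_mul_apply, map_add, map_smul, map_neg, smul_add, Ad_Ad_inv_apply]
  abel

/-- Along two families of points of `P × G × S¹` over the same family of points of `M × S¹`,
the forms `calForm` differ by a gauge transformation, which is trivial where the families have the
same classes in the caloron transform. -/
theorem exists_gauge {n : ℕ} {a a' : Euc n → P} (ha : IsPlot a) (ha' : IsPlot a')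
    {g g' : Euc n → G} (hg : ContMDiff 𝓘(ℝ, Euc n) 𝓘(ℝ, E) ∞ g)
    (hg' : ContMDiff 𝓘(ℝ, Euc n) 𝓘(ℝ, E) ∞ g') {θ θ' : Euc n → ℝ} (hθ : ContDiff ℝ ∞ θ)
    (hθ' : ContDiff ℝ ∞ θ') {x : Euc n} (hπ : ∀ᶠ y in 𝓝 x, B.proj (a y) = B.proj (a' y))
    (hθθ : ∀ᶠ y in 𝓝 x, (θ y : S1) = (θ' y : S1)) :
    ∃ h : Euc n → G, ContMDiff 𝓘(ℝ, Euc n) 𝓘(ℝ, E) ∞ h ∧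
      (calForm A Φ a' ha' g' θ' =ᶠ[𝓝 x]
        fun y => (Ad E (h y)⁻¹).comp (calForm A Φ a ha g θ y) + leftLog E h y) ∧
      ∀ᶠ y in 𝓝 x, B.cmk (a y) (g y) (θ y : S1) = B.cmk (a' y) (g' y) (θ' y : S1) → h y = 1 := by
  obtain ⟨γ, hγ, hγa⟩ := B.exists_smoothLoops ha ha' hπ
  have hγθ := hγ.contMDiff_eval hθ
  -- Chosen so that `γ` carries `(a, gh, θ)` to `(a', g', θ)`; the factor `h` then acts as in
  -- `calForm_mul`.
  let h : Euc n → G := fun y => (g y)⁻¹ * (γ y : S1 → G) (θ y : S1) * g' y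
  have hh : ContMDiff 𝓘(ℝ, Euc n) 𝓘(ℝ, E) ∞ h := (hg.inv.mul hγθ).mul hg'
  refine ⟨h, hh, ?_, ?_⟩
  · filter_upwards [hγa.eventually_nhds, hθθ.eventually_nhds] with y h1 h2
    rw [← calForm_mul A Φ ha hg hh, ← calForm_act A Φ ha (g := fun y => g y * h y) (hg.mul hh) hθ hγ]
    refine calForm_congr A Φ _ _ h1 (Filter.Eventually.of_forall fun z => ?_)
      hθ'.continuous.continuousAt hθ.continuous.continuousAt (h2.mono fun z hz => hz.symm)
    simp only [h]
    group
  · filter_upwards [hγa] with y h1 h2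
    obtain ⟨δ, hδ⟩ := Quotient.exact h2
    simp only [Prod.mk.injEq] at hδ
    obtain ⟨h3, h4, -⟩ := hδ
    have h5 : γ y = δ := act_injective (h1.symm.trans h3)
    simp only [h, h4, h5]
    group

theorem calForm_eq_of_cmk_eq {n : ℕ} {a a' : Euc n → P} (ha : IsPlot a) (ha' : IsPlot a')
    {g g' : Euc n → G} (hg : ContMDiff 𝓘(ℝ, Euc n) 𝓘(ℝ, E) ∞ g)
    (hg' : ContMDiff 𝓘(ℝ, Euc n) 𝓘(ℝ, E) ∞ g') {θ θ' : Euc n → ℝ} (hθ : ContDiff ℝ ∞ θ)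
    (hθ' : ContDiff ℝ ∞ θ') {x : Euc n}
    (h : ∀ᶠ y in 𝓝 x, B.cmk (a y) (g y) (θ y : S1) = B.cmk (a' y) (g' y) (θ' y : S1)) :
    calForm A Φ a ha g θ x = calForm A Φ a' ha' g' θ' x := by
  have h0 : ∀ᶠ y in 𝓝 x, (B.proj (a y), (θ y : S1)) = (B.proj (a' y), (θ' y : S1)) :=
    h.mono fun y hy => congrArg B.cproj hy
  obtain ⟨c, -, h1, h2⟩ := exists_gauge A Φ ha ha' hg hg' hθ hθ'
    (h0.mono fun y hy => congrArg Prod.fst hy) (h0.mono fun y hy => congrArg Prod.snd hy)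
  have h3 : c =ᶠ[𝓝 x] fun _ => 1 := by
    filter_upwards [h, h2] with y hy hy2 using hy2 hy
  rw [h1.eq_of_nhds, leftLog_congr h3, h3.eq_of_nhds, leftLog_const, inv_one, Ad_one,
    ContinuousLinearMap.id_comp, add_zero]

end LoopBundle

end

end Caloron

namespace Caloron

noncomputable section

/-! ### One-forms as families of linear maps -/

section OneForm

variable {E : Type*} [NormedAddCommGroup E] [NormedSpace ℝ E]
  {X : Type*} [DiffeologicalSpace X] {n : ℕ}

/-- The linear forms underlying a one-form, along a plot. -/
def DForm.linear (α : DForm X E 1) (q : Euc n → X) (hq : IsPlot q) (x : Euc n) : Euc n →L[ℝ] E :=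
  (ContinuousAlternatingMap.ofSubsingletonLIE (𝕜 := ℝ) (E := Euc n) (F := E) (0 : Fin 1)).symm (α.onPlot q hq x)

theorem DForm.linear_apply (α : DForm X E 1) (q : Euc n → X) (hq : IsPlot q) (x v : Euc n) :
    α.linear q hq x v = α.onPlot q hq x ![v] :=
  congrArg (α.onPlot q hq x) (funext fun i => by fin_cases i; rfl)

theorem DForm.contDiff_linear (α : DForm X E 1) (q : Euc n → X) (hq : IsPlot q) :
    ContDiff ℝ ∞ (α.linear q hq) :=
  (LinearIsometryEquiv.contDiff _).comp (α.smooth q hq)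

theorem DForm.linear_pullback {m : ℕ} (α : DForm X E 1) (q : Euc n → X) (hq : IsPlot q)
    {φ : Euc m → Euc n} (hφ : ContDiff ℝ ∞ φ) (x : Euc m) :
    α.linear (q ∘ φ) (isPlot_reparam hq hφ) x = (α.linear q hq (φ x)).comp (fderiv ℝ φ x) := by
  ext v
  rw [ContinuousLinearMap.comp_apply, linear_apply, linear_apply, α.pullback q hq φ hφ]
  exact congrArg (α.onPlot q hq (φ x)) (funext fun i => by fin_cases i; rfl)

theorem DForm.linear_congr (α : DForm X E 1) {q q' : Euc n → X} (hq : IsPlot q)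
    (hq' : IsPlot q') {x : Euc n} (h : q =ᶠ[𝓝 x] q') :
    α.linear q hq x = α.linear q' hq' x := by
  unfold linear
  rw [α.onPlot_congr hq hq' h]

theorem extDeriv_eq_fderiv_sub {F : Type*} [NormedAddCommGroup F] [NormedSpace ℝ F]
    {η : F → F [⋀^Fin 1]→L[ℝ] E} {α : F → F →L[ℝ] E} {x : F} (hη : DifferentiableAt ℝ η x)
    (hα : DifferentiableAt ℝ α x) (h : ∀ y v, α y v = η y ![v]) (u v : F) :
    extDeriv η x ![u, v] = fderiv ℝ α x u v - fderiv ℝ α x v u := by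
  have h1 : ∀ w : Fin 1 → F, (fun y => η y w) = fun y => α y (w 0) := fun w => funext fun y => by
    rw [h]
    exact congrArg (η y) (funext fun i => by fin_cases i; rfl)
  rw [extDeriv_apply hη, Fin.sum_univ_two]
  simp only [h1, fderiv_apply_clm hα]
  simp [Fin.removeNth, sub_eq_add_neg]

end OneForm

variable {E : Type*} [NormedAddCommGroup E] [NormedSpace ℝ E] [FiniteDimensional ℝ E]
  {G : Type*} [TopologicalSpace G] [ChartedSpace E G] [Group G] [LieGroup 𝓘(ℝ, E) ∞ G]
  {P : Type*} [DiffeologicalSpace P] {M : Type*} [DiffeologicalSpace M]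

/-! ### Existence and uniqueness of the caloron connection and its Chern-Weil form -/

namespace LoopBundle

variable {B : LoopBundle E G P M} {A : B.Connection} {Φ : B.HiggsField}

theorem curvature_eq (Ã : DForm B.Total E 1) {n : ℕ} (q : Euc n → B.Total) (hq : IsPlot q)
    (x u v : Euc n) : curvature Ã q hq x u v = curv G (Ã.linear q hq) x u v := by
  rw [curvature, curv_apply, Ã.linear_apply, Ã.linear_apply, extDeriv_eq_fderiv_sub
    ((Ã.smooth q hq).contDiffAt.differentiableAt (by simp))
    ((Ã.contDiff_linear q hq).contDiffAt.differentiableAt (by simp)) (Ã.linear_apply q hq)]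

variable (A Φ) in
theorem exists_isCaloronConnection : ∃ Ã : DForm B.Total E 1, IsCaloronConnection A Φ Ã := by
  let L (n : ℕ) := ContinuousAlternatingMap.ofSubsingletonLIE (𝕜 := ℝ) (E := Euc n) (F := E) (0 : Fin 1)
  obtain ⟨Ã, hÃ⟩ := exists_dForm (X := B.Total) (V := E) (k := 1)
    (fun n q w => ∃ (a : Euc n → P) (g : Euc n → G) (θ : Euc n → ℝ) (ha : IsPlot a)
      (_ : ContMDiff 𝓘(ℝ, Euc n) 𝓘(ℝ, E) ∞ g) (_ : ContDiff ℝ ∞ θ),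
      q = (fun x => B.cmk (a x) (g x) (θ x : S1)) ∧ w = fun x => L n (calForm A Φ a ha g θ x))
    (by
      rintro n _ _ ⟨a, g, θ, ha, hg, hθ, rfl, rfl⟩
      exact (L n).contDiff.comp (contDiff_calForm A Φ ha hg hθ))
    (by
      rintro m n _ _ φ hφ ⟨a, g, θ, ha, hg, hθ, rfl, rfl⟩
      refine ⟨a ∘ φ, g ∘ φ, θ ∘ φ, isPlot_reparam ha hφ, hg.comp hφ.contMDiff, hθ.comp hφ, rfl,
        funext fun x => ?_⟩
      rw [calForm_pullback A Φ ha hg hθ hφ]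
      rfl)
    (by
      rintro n _ _ _ _ x ⟨a, g, θ, ha, hg, hθ, rfl, rfl⟩ ⟨a', g', θ', ha', hg', hθ', rfl, rfl⟩ h
      exact congrArg (L n) (calForm_eq_of_cmk_eq A Φ ha ha' hg hg' hθ hθ' h))
    (fun n q hq x => by
      obtain ⟨a, g, θ, ha, hg, hθ, h⟩ := B.exists_lift_total hq x
      exact ⟨_, _, ⟨a, g, θ, ha, hg, hθ, rfl, rfl⟩, h⟩)
  refine ⟨Ã, fun n a g θ ha hg hθ x v => ?_⟩
  rw [hÃ n _ _ (B.isPlot_cmk ha hg hθ) ⟨a, g, θ, ha, hg, hθ, rfl, rfl⟩]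
  exact congrArg (calForm A Φ a ha g θ x) rfl

omit [FiniteDimensional ℝ E] in
theorem IsCaloronConnection.linear_eq {Ã : DForm B.Total E 1} (h : IsCaloronConnection A Φ Ã)
    {n : ℕ} {a : Euc n → P} {g : Euc n → G} {θ : Euc n → ℝ} (ha : IsPlot a)
    (hg : ContMDiff 𝓘(ℝ, Euc n) 𝓘(ℝ, E) ∞ g) (hθ : ContDiff ℝ ∞ θ) {q : Euc n → B.Total}
    (hq : IsPlot q) {x : Euc n} (hqx : q =ᶠ[𝓝 x] fun y => B.cmk (a y) (g y) (θ y : S1)) :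
    Ã.linear q hq =ᶠ[𝓝 x] calForm A Φ a ha g θ := by
  filter_upwards [hqx.eventually_nhds] with y hy
  rw [Ã.linear_congr hq (B.isPlot_cmk ha hg hθ) hy]
  ext v
  rw [Ã.linear_apply, h n a g θ ha hg hθ, calForm_apply]

omit [FiniteDimensional ℝ E] in
theorem IsCaloronConnection.unique {Ã Ã' : DForm B.Total E 1} (h : IsCaloronConnection A Φ Ã)
    (h' : IsCaloronConnection A Φ Ã') : Ã = Ã' := by
  ext n q hq x v
  obtain ⟨a, g, θ, ha, hg, hθ, hx⟩ := B.exists_lift_total hq x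
  have h1 := (h.linear_eq ha hg hθ hq hx).eq_of_nhds
  rw [← (h'.linear_eq ha hg hθ hq hx).eq_of_nhds] at h1
  exact DFunLike.congr_fun ((LinearIsometryEquiv.injective _) h1) v

theorem isChernWeilForm_iff {k : ℕ} {f : InvariantPolynomial E G k} {Ã : DForm B.Total E 1}
    {β : DForm (M × S1) ℝ (2 * k)} : IsChernWeilForm f Ã β ↔
      ∀ (n : ℕ) (q : Euc n → B.Total) (hq : IsPlot q),
        β.onPlot (B.cproj ∘ q) (B.dSmooth_cproj n q hq) =
          fun x => cwForm f (curv G (Ã.linear q hq) x) := by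
  unfold IsChernWeilForm
  simp only [curvature_eq]
  refine forall₃_congr fun n q hq => ⟨fun h => funext fun x => ?_, fun h x v => ?_⟩
  · ext v
    rw [h x v, cwForm_apply]
  · rw [h, cwForm_apply]

/-- Plots of the total space over the same plot of `M × S¹` differ by a gauge transformation, which
conjugates the curvature; `f` does not see the conjugation. This is the descent to `M × S¹`. -/
theorem IsCaloronConnection.cwForm_eq {k : ℕ} (f : InvariantPolynomial E G k)
    {Ã : DForm B.Total E 1} (h : IsCaloronConnection A Φ Ã) {n : ℕ} {q q' : Euc n → B.Total}
    (hq : IsPlot q) (hq' : IsPlot q') {x : Euc n} (hqq : B.cproj ∘ q =ᶠ[𝓝 x] B.cproj ∘ q') :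
    cwForm f (curv G (Ã.linear q hq) x) = cwForm f (curv G (Ã.linear q' hq') x) := by
  obtain ⟨a, g, θ, ha, hg, hθ, hx⟩ := B.exists_lift_total hq x
  obtain ⟨a', g', θ', ha', hg', hθ', hx'⟩ := B.exists_lift_total hq' x
  have h0 : ∀ᶠ y in 𝓝 x, (B.proj (a y), (θ y : S1)) = (B.proj (a' y), (θ' y : S1)) := by
    filter_upwards [hx, hx', hqq] with y hy hy' hyy
    rw [Function.comp_apply, Function.comp_apply, hy, hy'] at hyy
    exact hyy
  obtain ⟨c, hc, h1, -⟩ := exists_gauge A Φ ha ha' hg hg' hθ hθ'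
    (h0.mono fun y hy => congrArg Prod.fst hy) (h0.mono fun y hy => congrArg Prod.snd hy)
  rw [curv_congr (h.linear_eq ha hg hθ hq hx),
    curv_congr ((h.linear_eq ha' hg' hθ' hq' hx').trans h1)]
  ext v
  simp only [cwForm_apply, curv_gauge
    ((contDiff_calForm A Φ ha hg hθ).contDiffAt.differentiableAt (by simp)) hc, f.invariant]

theorem IsCaloronConnection.exists_isChernWeilForm {k : ℕ} (f : InvariantPolynomial E G k)
    {Ã : DForm B.Total E 1} (h : IsCaloronConnection A Φ Ã) :
    ∃ β : DForm (M × S1) ℝ (2 * k), IsChernWeilForm f Ã β := by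
  obtain ⟨β, hβ⟩ := exists_dForm (X := M × S1) (V := ℝ) (k := 2 * k)
    (fun n c w => ∃ (q : Euc n → B.Total) (hq : IsPlot q), c = B.cproj ∘ q ∧
      w = fun x => cwForm f (curv G (Ã.linear q hq) x))
    (by
      rintro n _ _ ⟨q, hq, rfl, rfl⟩
      exact contDiff_cwForm f (contDiff_curv (Ã.contDiff_linear q hq)))
    (by
      rintro m n _ _ φ hφ ⟨q, hq, rfl, rfl⟩
      refine ⟨q ∘ φ, isPlot_reparam hq hφ, rfl, funext fun x => ?_⟩
      have h1 : Ã.linear (q ∘ φ) (isPlot_reparam hq hφ) = _ :=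
        funext fun x => Ã.linear_pullback q hq hφ x
      ext v
      rw [h1]
      simp only [ContinuousAlternatingMap.compContinuousLinearMap_apply, cwForm_apply,
        curv_pullback ((Ã.contDiff_linear q hq).contDiffAt.differentiableAt (by simp))
          hφ.contDiffAt, Function.comp_apply])
    (by
      rintro n _ _ _ _ x ⟨q, hq, rfl, rfl⟩ ⟨q', hq', rfl, rfl⟩ hqq
      exact h.cwForm_eq f hq hq' hqq)
    (fun n c hc x => by
      obtain ⟨q, hq, hx⟩ := B.exists_lift_cproj hc x
      exact ⟨_, _, ⟨q, hq, rfl, rfl⟩, hx⟩)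
  exact ⟨β, isChernWeilForm_iff.2 fun n q hq => hβ n _ _ _ ⟨q, hq, rfl, rfl⟩⟩

theorem IsChernWeilForm.unique {k : ℕ} {f : InvariantPolynomial E G k} {Ã : DForm B.Total E 1}
    {β β' : DForm (M × S1) ℝ (2 * k)} (h : IsChernWeilForm f Ã β) (h' : IsChernWeilForm f Ã β') :
    β = β' := by
  rw [isChernWeilForm_iff] at h h'
  ext n c hc x v
  obtain ⟨q, hq, hx⟩ := B.exists_lift_cproj hc x
  rw [β.onPlot_congr hc (B.dSmooth_cproj n q hq) hx, β'.onPlot_congr hc (B.dSmooth_cproj n q hq) hx,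
    h n q hq, h' n q hq]

theorem IsChernWeilForm.isClosed {k : ℕ} {f : InvariantPolynomial E G k} {Ã : DForm B.Total E 1}
    {β : DForm (M × S1) ℝ (2 * k)} (h : IsChernWeilForm f Ã β) : β.IsClosed := by
  rw [isChernWeilForm_iff] at h
  intro n c hc x
  obtain ⟨q, hq, hx⟩ := B.exists_lift_cproj hc x
  have h1 : β.onPlot c hc =ᶠ[𝓝 x] fun y => cwForm f (curv G (Ã.linear q hq) y) := by
    filter_upwards [hx.eventually_nhds] with y hy
    rw [β.onPlot_congr hc (B.dSmooth_cproj n q hq) hy, h n q hq]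
  rw [h1.extDeriv.eq_of_nhds, extDeriv_cwForm_curv f (Ã.contDiff_linear q hq)]

end LoopBundle

end

end Caloron

namespace Caloron

noncomputable section

/-! ### Differentiation under the integral sign -/

section ParametricIntegral

variable {F : Type*} [NormedAddCommGroup F] [NormedSpace ℝ F] [FiniteDimensional ℝ F]

theorem hasFDerivAt_intervalIntegral {f : F × ℝ → ℝ} (hf : ContDiff ℝ ∞ f) (a b : ℝ) (x : F) :
    HasFDerivAt (fun y => ∫ t in a..b, f (y, t))
      (∫ t in a..b, (fderiv ℝ f (x, t)).comp (ContinuousLinearMap.inl ℝ F ℝ)) x := by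
  have hc : Continuous (fun z : F × ℝ => (fderiv ℝ f z).comp (ContinuousLinearMap.inl ℝ F ℝ)) :=
    (hf.continuous_fderiv (by simp)).clm_comp continuous_const
  have hK : IsCompact (Metric.closedBall x 1 ×ˢ Set.uIcc a b) :=
    (isCompact_closedBall x 1).prod isCompact_uIcc
  -- The dominating function is a constant: the partial derivative is bounded on a compact ball
  -- times the interval.
  obtain ⟨C, hC⟩ := hK.exists_bound_of_continuousOn hc.continuousOn
  refine intervalIntegral.hasFDerivAt_integral_of_dominated_of_fderiv_le
    (F' := fun y t => (fderiv ℝ f (y, t)).comp (ContinuousLinearMap.inl ℝ F ℝ))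
    (bound := fun _ => C) (Metric.closedBall_mem_nhds x one_pos)
    (Filter.Eventually.of_forall fun y => ?_) ?_ ?_ ?_ ?_ ?_
  · exact (hf.continuous.comp (Continuous.prodMk_right y)).aestronglyMeasurable
  · exact (hf.continuous.comp (Continuous.prodMk_right x)).intervalIntegrable _ _
  · exact (hc.comp (Continuous.prodMk_right x)).aestronglyMeasurable
  · exact Filter.Eventually.of_forall fun t ht y hy => hC (y, t) ⟨hy, Set.uIoc_subset_uIcc ht⟩
  · exact intervalIntegrable_const
  · refine Filter.Eventually.of_forall fun t _ y _ => ?_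
    exact (hf.contDiffAt.differentiableAt (by simp)).hasFDerivAt.comp y
      (hasFDerivAt_prodMk_left y t)

theorem fderiv_intervalIntegral {f : F × ℝ → ℝ} (hf : ContDiff ℝ ∞ f) (a b : ℝ) (x v : F) :
    fderiv ℝ (fun y => ∫ t in a..b, f (y, t)) x v = ∫ t in a..b, fderiv ℝ f (x, t) (v, 0) := by
  have hc : Continuous (fun z : F × ℝ => (fderiv ℝ f z).comp (ContinuousLinearMap.inl ℝ F ℝ)) :=
    (hf.continuous_fderiv (by simp)).clm_comp continuous_const
  rw [(hasFDerivAt_intervalIntegral hf a b x).fderiv]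
  exact ContinuousLinearMap.intervalIntegral_apply
    ((hc.comp (Continuous.prodMk_right x)).intervalIntegrable _ _) v

theorem contDiff_intervalIntegral {f : F × ℝ → ℝ} (hf : ContDiff ℝ ∞ f) (a b : ℝ) :
    ContDiff ℝ ∞ (fun y => ∫ t in a..b, f (y, t)) := by
  rw [contDiff_infty]
  intro n
  induction n generalizing f with
  | zero =>
    rw [Nat.cast_zero, contDiff_zero]
    exact intervalIntegral.continuous_parametric_intervalIntegral_of_continuous'
      (f := fun y t => f (y, t)) hf.continuous a b
  | succ n ih =>
    rw [Nat.cast_add, Nat.cast_one, contDiff_succ_iff_fderiv_apply]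
    refine ⟨fun x => (hasFDerivAt_intervalIntegral hf a b x).differentiableAt, by simp, fun v => ?_⟩
    simp only [fderiv_intervalIntegral hf]
    exact ih (f := fun z => fderiv ℝ f z (v, 0))
      ((hf.fderiv_right (m := ∞) (by simp)).clm_apply contDiff_const)

end ParametricIntegral

/-! ### Linear coordinates on `ℝⁿ × ℝ` -/

section Cylinder

/-- `(x, t) ↦ (x, t)`, as a linear map `ℝⁿ × ℝ → ℝⁿ⁺¹`. -/
def snocL (n : ℕ) : Euc n × ℝ →L[ℝ] Euc (n + 1) :=
  LinearMap.toContinuousLinearMap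
    { toFun := fun z => snocE z.1 z.2
      map_add' := fun z w => by
        ext i
        refine Fin.lastCases ?_ (fun i => ?_) i <;> simp [snocE]
      map_smul' := fun c z => by
        ext i
        refine Fin.lastCases ?_ (fun i => ?_) i <;> simp [snocE] }

theorem snocL_apply {n : ℕ} (x : Euc n) (t : ℝ) : snocL n (x, t) = snocE x t := rfl

/-- The projection `ℝⁿ⁺¹ → ℝⁿ`, as a linear map. -/
def initL (n : ℕ) : Euc (n + 1) →L[ℝ] Euc n :=
  LinearMap.toContinuousLinearMap
    { toFun := initE
      map_add' := fun _ _ => rfl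
      map_smul' := fun _ _ => rfl }

theorem initL_apply {n : ℕ} (y : Euc (n + 1)) : initL n y = initE y := rfl

@[simp]
theorem initE_snocE {n : ℕ} (x : Euc n) (t : ℝ) : initE (snocE x t) = x := by
  ext i
  simp [initE, snocE]

@[simp]
theorem snocE_last {n : ℕ} (x : Euc n) (t : ℝ) : snocE x t (Fin.last n) = t := by
  simp [snocE]

/-- The map `(x, t) ↦ (φ(x), t)`. -/
def cylMap {m n : ℕ} (φ : Euc m → Euc n) (y : Euc (m + 1)) : Euc (n + 1) :=
  snocE (φ (initE y)) (y (Fin.last m))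

theorem cyl_comp {M : Type*} {m n : ℕ} (p : Euc n → M) (φ : Euc m → Euc n) :
    cyl (p ∘ φ) = cyl p ∘ cylMap φ := by
  ext y <;> simp [cyl, cylMap]

theorem hasFDerivAt_cylMap {m n : ℕ} {φ : Euc m → Euc n} {y : Euc (m + 1)}
    (hφ : DifferentiableAt ℝ φ (initE y)) :
    HasFDerivAt (cylMap φ) ((snocL n).comp (((fderiv ℝ φ (initE y)).comp (initL m)).prod
      (EuclideanSpace.proj (Fin.last m)))) y :=
  (snocL n).hasFDerivAt.comp y ((HasFDerivAt.comp y (g := φ) (f := initE) hφ.hasFDerivAt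
    (initL m).hasFDerivAt).prodMk (EuclideanSpace.proj (𝕜 := ℝ) (Fin.last m)).hasFDerivAt)

theorem contDiff_cylMap {m n : ℕ} {φ : Euc m → Euc n} (hφ : ContDiff ℝ ∞ φ) :
    ContDiff ℝ ∞ (cylMap φ) :=
  (snocL n).contDiff.comp ((hφ.comp (initL m).contDiff).prodMk
    (EuclideanSpace.proj (𝕜 := ℝ) (Fin.last m)).contDiff)

end Cylinder

/-! ### Existence, uniqueness and closedness of the fibre integral -/

section FibreIntegral

variable {M : Type*} [DiffeologicalSpace M] {q : ℕ}

/-- The vectors `(v₁, 0), …, (v_q, 0), (0, 1)`. -/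
def cylVec {n q : ℕ} (v : Fin q → Euc n) : Fin (q + 1) → Euc (n + 1) :=
  Fin.snoc (α := fun _ => Euc (n + 1)) (fun i => snocE (v i) 0) (snocE 0 1)

/-- Contraction of a form on `ℝⁿ × ℝ` with the unit vector of `ℝ` in the last slot. -/
def contractLast {n : ℕ} (η : Euc (n + 1) [⋀^Fin (q + 1)]→L[ℝ] ℝ) : Euc n [⋀^Fin q]→L[ℝ] ℝ :=
  (-1 : ℝ) ^ q • (η.curryLeft (snocE 0 1)).compContinuousLinearMap
    ((snocL n).comp (ContinuousLinearMap.inl ℝ (Euc n) ℝ))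

/-- Moving the contracted vector from the last slot to the first costs the sign `(-1)^q`. -/
theorem contractLast_apply {n : ℕ} (η : Euc (n + 1) [⋀^Fin (q + 1)]→L[ℝ] ℝ) (v : Fin q → Euc n) :
    contractLast η v = η (cylVec v) := by
  have h := η.map_insertNth (Fin.last q) (snocE 0 1) (fun i => snocE (v i) 0)
  rw [Fin.insertNth_last'] at h
  rw [cylVec, h]
  simp [contractLast, ContinuousAlternatingMap.curryLeft_apply_apply]
  rfl

variable (β : DForm (M × S1) ℝ (q + 1))

theorem contDiff_onPlot_cyl {n : ℕ} (p : Euc n → M) (hp : IsPlot p)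
    (w : Fin (q + 1) → Euc (n + 1)) :
    ContDiff ℝ ∞ (fun z : Euc n × ℝ => β.onPlot (cyl p) (isPlot_cyl hp) (snocE z.1 z.2) w) :=
  (ContinuousAlternatingMap.apply ℝ (Euc (n + 1)) ℝ w).contDiff.comp
    ((β.smooth (cyl p) (isPlot_cyl hp)).comp (snocL n).contDiff)

theorem continuous_contractLast_onPlot {n : ℕ} (p : Euc n → M) (hp : IsPlot p) (x : Euc n) :
    Continuous (fun t : ℝ => contractLast (β.onPlot (cyl p) (isPlot_cyl hp) (snocE x t))) := by
  refine ContDiff.continuous (𝕜 := ℝ) (n := ∞) (contDiff_alternating fun v => ?_)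
  simp only [contractLast_apply]
  exact (contDiff_onPlot_cyl β p hp (cylVec v)).comp (contDiff_const.prodMk contDiff_id)

theorem integral_contractLast_apply {n : ℕ} (p : Euc n → M) (hp : IsPlot p) (x : Euc n)
    (a b : ℝ) (v : Fin q → Euc n) :
    (∫ t in a..b, contractLast (β.onPlot (cyl p) (isPlot_cyl hp) (snocE x t))) v =
      ∫ t in a..b, β.onPlot (cyl p) (isPlot_cyl hp) (snocE x t) (cylVec v) := by
  simp only [← contractLast_apply]
  exact ((ContinuousAlternatingMap.apply ℝ (Euc n) ℝ v).intervalIntegral_comp_comm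
    ((continuous_contractLast_onPlot β p hp x).intervalIntegrable _ _)).symm

theorem onPlot_cyl_comp {m n : ℕ} {p : Euc n → M} (hp : IsPlot p) {φ : Euc m → Euc n}
    (hφ : ContDiff ℝ ∞ φ) (x : Euc m) (t : ℝ) (v : Fin q → Euc m) :
    β.onPlot (cyl (p ∘ φ)) (isPlot_cyl (isPlot_reparam hp hφ)) (snocE x t) (cylVec v) =
      β.onPlot (cyl p) (isPlot_cyl hp) (snocE (φ x) t) (cylVec fun i => fderiv ℝ φ x (v i)) := by
  rw [β.onPlot_of_eq _ (isPlot_reparam (isPlot_cyl hp) (contDiff_cylMap hφ)) (cyl_comp p φ),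
    β.pullback _ (isPlot_cyl hp) _ (contDiff_cylMap hφ), (hasFDerivAt_cylMap
      (hφ.contDiffAt.differentiableAt (by simp))).fderiv]
  have h1 : cylMap φ (snocE x t) = snocE (φ x) t := by simp [cylMap]
  rw [h1, ContinuousAlternatingMap.compContinuousLinearMap_apply]
  congr 1
  funext i
  refine Fin.lastCases ?_ (fun i => ?_) i <;>
    simp [cylVec, initL_apply, snocL_apply]

theorem exists_isFibreIntegral : ∃ σ : DForm M ℝ q, IsFibreIntegral β σ := by
  refine ⟨⟨fun p hp x => ∫ t in (0 : ℝ)..(2 * Real.pi),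
    contractLast (β.onPlot (cyl p) (isPlot_cyl hp) (snocE x t)), ?_, ?_⟩, ?_⟩
  · intro n p hp
    refine contDiff_alternating fun v => ?_
    simp only [integral_contractLast_apply β p hp]
    exact contDiff_intervalIntegral (contDiff_onPlot_cyl β p hp (cylVec v)) _ _
  · intro m n p hp φ hφ x
    ext v
    rw [ContinuousAlternatingMap.compContinuousLinearMap_apply, integral_contractLast_apply β _ (isPlot_reparam hp hφ),
      integral_contractLast_apply β _ hp]
    simp only [onPlot_cyl_comp β hp hφ]
    rfl
  · intro n p hp x v
    exact integral_contractLast_apply β p hp x _ _ v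

variable {β}

theorem IsFibreIntegral.unique {σ σ' : DForm M ℝ q} (h : IsFibreIntegral β σ)
    (h' : IsFibreIntegral β σ') : σ = σ' := by
  ext n p hp x v
  rw [h n p hp x v, h' n p hp x v]

/-- Translation by `2π` in the last coordinate preserves the plot `cyl p` and has identity
differential. This is how the closedness of the circle enters. -/
theorem onPlot_cyl_add_two_pi {n : ℕ} {p : Euc n → M} (hp : IsPlot p) (x : Euc n) :
    β.onPlot (cyl p) (isPlot_cyl hp) (snocE x (2 * Real.pi)) =
      β.onPlot (cyl p) (isPlot_cyl hp) (snocE x 0) := by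
  have h1 : cyl p ∘ (fun y => y + snocE 0 (2 * Real.pi)) = cyl p := by
    ext y
    · have h : initE (y + snocE 0 (2 * Real.pi)) = initE y := by
        rw [← initL_apply, map_add, initL_apply, initL_apply, initE_snocE, add_zero]
      simp [cyl, h]
    · simp [cyl]
  have hτ : ContDiff ℝ ∞ (fun y : Euc (n + 1) => y + snocE 0 (2 * Real.pi)) :=
    contDiff_id.add contDiff_const
  have h2 := β.pullback _ (isPlot_cyl hp) _ hτ (snocE x 0)
  rw [β.onPlot_of_eq _ (isPlot_cyl hp) h1, fderiv_add_const, fderiv_fun_id] at h2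
  have h3 : snocE x 0 + snocE 0 (2 * Real.pi) = snocE x (2 * Real.pi) := by
    rw [← snocL_apply, ← snocL_apply, ← map_add, Prod.mk_add_mk, add_zero, zero_add, snocL_apply]
  rw [h3] at h2
  exact h2.symm

theorem removeNth_castSucc_cylVec {n : ℕ} (v : Fin (q + 1) → Euc n) (i : Fin (q + 1)) :
    i.castSucc.removeNth (cylVec v) = cylVec (i.removeNth v) := by
  funext j
  refine Fin.lastCases ?_ (fun j => ?_) j
  · simp [cylVec, Fin.removeNth]
  · simp [cylVec, Fin.removeNth]

/-- The integral over the fibre of a closed form is closed. -/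
theorem IsFibreIntegral.isClosed {σ : DForm M ℝ q} (h : IsFibreIntegral β σ) (hβ : β.IsClosed) :
    σ.IsClosed := by
  intro n p hp x
  ext v
  rw [extDeriv_apply ((σ.smooth p hp).contDiffAt.differentiableAt (by simp))]
  let f (w : Fin (q + 1) → Euc (n + 1)) (y : Euc (n + 1)) : ℝ :=
    β.onPlot (cyl p) (isPlot_cyl hp) y w
  have hf : ∀ w, ContDiff ℝ ∞ (f w) := fun w =>
    (ContinuousAlternatingMap.apply ℝ (Euc (n + 1)) ℝ w).contDiff.comp (β.smooth _ _)
  have hd : ∀ w, Differentiable ℝ (f w) := fun w => (hf w).differentiable (by simp)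
  have hfz : ∀ w z u, fderiv ℝ (fun z : Euc n × ℝ => f w (snocE z.1 z.2)) z u =
      fderiv ℝ (f w) (snocE z.1 z.2) (snocE u.1 u.2) := fun w z u =>
    DFunLike.congr_fun ((hd w _).hasFDerivAt.comp z (snocL n).hasFDerivAt).fderiv u
  have hc : ∀ w u, Continuous (fun t : ℝ => fderiv ℝ (f w) (snocE x t) u) := fun w u =>
    (((hf w).continuous_fderiv (by simp)).comp ((snocL n).continuous.comp
      (Continuous.prodMk_right x))).clm_apply continuous_const
  have h1 : ∀ i : Fin (q + 1), fderiv ℝ (fun y => σ.onPlot p hp y (i.removeNth v)) x (v i) =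
      ∫ t in (0 : ℝ)..(2 * Real.pi),
        fderiv ℝ (f (cylVec (i.removeNth v))) (snocE x t) (snocE (v i) 0) := by
    intro i
    have h2 : (fun y => σ.onPlot p hp y (i.removeNth v)) = fun y =>
        ∫ t in (0 : ℝ)..(2 * Real.pi), f (cylVec (i.removeNth v)) (snocE y t) :=
      funext fun y => h n p hp y _
    rw [h2, fderiv_intervalIntegral (contDiff_onPlot_cyl β p hp _)]
    exact intervalIntegral.integral_congr fun t _ => hfz _ (x, t) (v i, 0)
  -- Evaluating `dβ = 0` on `cylVec v` separates the derivatives along `M` from the one along the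
  -- circle.
  have h3 : ∀ t, ∑ i : Fin (q + 1), (-1 : ℝ) ^ (i : ℕ) *
      fderiv ℝ (f (cylVec (i.removeNth v))) (snocE x t) (snocE (v i) 0) =
        (-1 : ℝ) ^ q * fderiv ℝ (f fun i => snocE (v i) 0) (snocE x t) (snocE 0 1) := by
    intro t
    have h4 := DFunLike.congr_fun (hβ _ _ (isPlot_cyl hp) (snocE x t)) (cylVec v)
    rw [extDeriv_apply ((β.smooth _ _).contDiffAt.differentiableAt (by simp)),
      Fin.sum_univ_castSucc] at h4
    simp only [removeNth_castSucc_cylVec, Fin.removeNth_last] at h4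
    simp [cylVec, pow_succ] at h4
    exact eq_of_sub_eq_zero ((sub_eq_add_neg _ _).trans h4)
  have h5 : ∀ t, HasDerivAt (fun t => f (fun i => snocE (v i) 0) (snocE x t))
      (fderiv ℝ (f fun i => snocE (v i) 0) (snocE x t) (snocE 0 1)) t := by
    intro t
    have h6 := (hd (fun i => snocE (v i) 0) (snocE x t)).hasFDerivAt.comp_hasDerivAt t
      ((snocL n).hasFDerivAt.comp_hasDerivAt t ((hasDerivAt_const t x).prodMk (hasDerivAt_id t)))
    exact h6
  simp only [h1, Int.cast_pow, zsmul_eq_mul]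
  simp only [← intervalIntegral.integral_const_mul]
  rw [← intervalIntegral.integral_finsetSum fun i _ =>
    ((hc _ _).const_mul _).intervalIntegrable _ _]
  simp only [Int.cast_neg, Int.cast_one, h3]
  -- The circle derivative integrates to a difference of values at `2π` and `0`, which agree.
  rw [intervalIntegral.integral_const_mul, intervalIntegral.integral_eq_sub_of_hasDerivAt
    (fun t _ => h5 t) ((hc _ _).intervalIntegrable _ _)]
  simp only [f, onPlot_cyl_add_two_pi hp, sub_self, mul_zero]
  rfl

end FibreIntegral

end

end Caloron

/-! ### Assembly of the three stages -/

theorem propositionP {E : Type*} [NormedAddCommGroup E] [NormedSpace ℝ E] [FiniteDimensional ℝ E]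
    {G : Type*} [TopologicalSpace G] [ChartedSpace E G] [Group G] [LieGroup 𝓘(ℝ, E) ∞ G]
    [CompactSpace G] [ConnectedSpace G]
    {P : Type*} [DiffeologicalSpace P] {M : Type*} [DiffeologicalSpace M]
    (B : Caloron.LoopBundle E G P M) (A : B.Connection) (Φ : B.HiggsField)
    (k : ℕ) (f : Caloron.InvariantPolynomial E G (k + 1)) :
    (∃! s : Caloron.DForm M ℝ (2 * k + 1), Caloron.LoopBundle.IsStringForm A Φ f s) ∧
      ∀ s : Caloron.DForm M ℝ (2 * k + 1),
        Caloron.LoopBundle.IsStringForm A Φ f s → s.IsClosed := by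
  obtain ⟨Ã, hÃ⟩ := Caloron.LoopBundle.exists_isCaloronConnection A Φ
  obtain ⟨β, hβ⟩ := hÃ.exists_isChernWeilForm f
  -- The degree `2 * (k + 1)` of `β` is `(2 * k + 1) + 1` by definition, so no cast is needed.
  obtain ⟨σ, hσ⟩ := Caloron.exists_isFibreIntegral (q := 2 * k + 1) β
  refine ⟨⟨σ, ⟨Ã, β, hÃ, hβ, hσ⟩, ?_⟩, ?_⟩
  · rintro σ' ⟨Ã', β', hÃ', hβ', hσ'⟩
    obtain rfl := hÃ.unique hÃ'
    obtain rfl := hβ.unique hβ'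
    exact hσ'.unique hσ
  · rintro σ' ⟨Ã', β', -, hβ', hσ'⟩
    exact hσ'.isClosed hβ'.isClosed
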